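/- Let $p$ be a prime. For an $\mathbb F_p$-algebra $A$, let $\mathbb G_a^{\mathrm{perf}}$ be the ring scheme over $A$ representing $S\mapsto S^\flat:=\varprojlim_{x\mapsto x^p}S$ on $A$-algebras, and let $u:\mathbb G_a^{\mathrm{perf}}\to\mathbb G_a$ be the ring map $S^\flat\to S$, $(a_0,a_1,\dots)\mapsto a_0$. A pointed $\mathbb G_a^{\mathrm{perf}}$-module over $A$ is a presheaf $X$ of modules over the presheaf of rings $\mathbb G_a^{\mathrm{perf}}$ on affine $A$-schemes, whose underlying presheaf of sets is representable by an affine $A$-scheme, together with a map $X\to\mathbb G_a^{\mathrm{perf}}$ of $\mathbb G_a^{\mathrm{perf}}$-modules (the point). Isomorphisms are isomorphisms of presheaves of modules commuting with the points. Let $W[F]$ be the kernel of the Frobenius $F$ on the $p$-typical Witt vectors, with the $\mathbb G_a$-action induced by multiplication by $W(S)$ via $W(S)/VW(S)\cong S$, and with the map $W[F]\to\mathbb G_a$ given by the zeroth Witt component. Let $u^*W[F]:=W[F]\times_{\mathbb G_a}\mathbb G_a^{\mathrm{perf}}$, where $S^\flat$ acts on $W[F](S)$ through $u$, and with the second projection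 as point; it is a pointed $\mathbb G_a^{\mathrm{perf}}$-module over $\mathbb F_p$. A deformation of $u^*W[F]$ over $\mathbb F_p[\epsilon]/\epsilon^2$ is a pointed $\mathbb G_a^{\mathrm{perf}}$-module $X$ over $\mathbb F_p[\epsilon]/\epsilon^2$, flat over $\mathbb F_p[\epsilon]/\epsilon^2$, with an isomorphism $\iota: X\otimes_{\mathbb F_p[\epsilon]/\epsilon^2}\mathbb F_p\cong u^*W[F]$ of pointed $\mathbb G_a^{\mathrm{perf}}$-modules over $\mathbb F_p$ (base change along $\epsilon\mapsto 0$). The trivial deformation is the base change $u^*W[F]\otimes_{\mathbb F_p}\mathbb F_p[\epsilon]/\epsilon^2$ with its canonical identification. **Proposition.** The pointed $\mathbb G_a^{\mathrm{perf}}$-module $u^*W[F]$ over $\mathbb F_p$ has no nontrivial deformation over $\mathbb F_p[\epsilon]/\epsilon^2$. More precisely, for every deformation $(X,\iota)$ there is exactly one isomorphism $X\cong u^*W[F]\otimes_{\mathbb F_p}\mathbb F_p[\epsilon]/\epsilon^2$ of pointed $\mathbb G_a^{\mathrm{perf}}$-modules over $\mathbb F_p[\epsilon]/\epsilon^2$,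 and this isomorphism is compatible with $\iota$ and the canonical identification of the trivial deformation modulo $\epsilon$. -/

import Mathlib

universe u

open scoped TensorProduct

/-! ### The ring scheme `𝔾ₐ^perf` over a base of characteristic `p` -/

/-- `S^♭ = lim_{x ↦ x^p} S` for a ring `S` in which `p = 0`, with coordinatewise operations.
The functor `S ↦ S^♭` is the ring scheme `𝔾ₐ^perf`. -/
def tilt (p : ℕ) [Fact p.Prime] (S : Type u) [CommRing S] (hS : (p : S) = 0) :
    Subring (ℕ → S) where
  carrier := {a | ∀ n, a (n + 1) ^ p = a n}
  one_mem' n := one_pow p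
  mul_mem' {a b} ha hb n := by
    simp only [Set.mem_ofPred_eq] at ha hb
    simp [mul_pow, ha n, hb n]
  zero_mem' n := by simp [(Fact.out : p.Prime).ne_zero]
  add_mem' {a b} ha hb n := by
    simp only [Set.mem_ofPred_eq] at ha hb
    rcases subsingleton_or_nontrivial S with h | h
    · exact Subsingleton.elim _ _
    · have : CharP S p := (CharP.charP_iff_prime_eq_zero Fact.out).2 hS
      simp [add_pow_char, ha n, hb n]
  neg_mem' {a} ha n := by
    simp only [Set.mem_ofPred_eq] at ha
    rcases subsingleton_or_nontrivial S with h | h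
    · exact Subsingleton.elim _ _
    · have : CharP S p := (CharP.charP_iff_prime_eq_zero Fact.out).2 hS
      have h1 : (-a (n + 1)) ^ p = -(a (n + 1) ^ p) := by
        have := sub_pow_char (0 : S) (a (n + 1))
        simpa [(Fact.out : p.Prime).ne_zero] using this
      simp [h1, ha n]

/-- The ring homomorphism `S^♭ → T^♭` induced by `f : S → T`. -/
def tiltMap (p : ℕ) [Fact p.Prime] {S T : Type u} [CommRing S] [CommRing T]
    (hS : (p : S) = 0) (hT : (p : T) = 0) (f : S →+* T) : tilt p S hS →+* tilt p T hT where
  toFun a := ⟨fun n => f (a.1 n), fun n => by rw [← map_pow, a.2 n]⟩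
  map_one' := by ext n; simp
  map_mul' a b := by ext n; simp
  map_zero' := by ext n; simp
  map_add' a b := by ext n; simp

/-- The projection `u : S^♭ → S`, `(a₀, a₁, …) ↦ a₀`: the map of ring schemes `𝔾ₐ^perf → 𝔾ₐ`. -/
def untilt (p : ℕ) [Fact p.Prime] (S : Type u) [CommRing S] (hS : (p : S) = 0) :
    tilt p S hS →+* S :=
  (Pi.evalRingHom (fun _ : ℕ => S) 0).comp (tilt p S hS).subtype

/-- In an algebra over an `𝔽_p`-algebra, `p = 0`. -/
theorem natCast_eq_zero_of_algebra (p : ℕ) (A : Type u) [CommRing A] [Algebra (ZMod p) A]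
    (S : Type u) [CommRing S] [Algebra A S] : (p : S) = 0 := by
  have h : (p : A) = 0 := by
    rw [← map_natCast (algebraMap (ZMod p) A) p, ZMod.natCast_self, map_zero]
  rw [← map_natCast (algebraMap A S) p, h, map_zero]

/-! ### Pointed `𝔾ₐ`-modules and pointed `𝔾ₐ^perf`-modules -/

/-- A pointed `𝔾ₐ`-module over `A`: a presheaf of modules `S ↦ pts S` over the presheaf of rings
`𝔾ₐ : S ↦ S` on affine `A`-schemes, whose underlying presheaf of sets is representable by an
affine `A`-scheme `Spec B` (with universal point `ξ ∈ pts B`), and a map of `𝔾ₐ`-modules to `𝔾ₐ`. -/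
structure PointedGaModule (A : Type u) [CommRing A] where
  pts (S : Type u) [CommRing S] [Algebra A S] : Type u
  [grp (S : Type u) [CommRing S] [Algebra A S] : AddCommGroup (pts S)]
  [mod (S : Type u) [CommRing S] [Algebra A S] : Module S (pts S)]
  map {S T : Type u} [CommRing S] [Algebra A S] [CommRing T] [Algebra A T] (f : S →ₐ[A] T) :
    pts S →+ pts T
  map_id (S : Type u) [CommRing S] [Algebra A S] (x : pts S) : map (AlgHom.id A S) x = x
  map_comp {S T U : Type u} [CommRing S] [Algebra A S] [CommRing T] [Algebra A T]
    [CommRing U] [Algebra A U] (f : S →ₐ[A] T) (g : T →ₐ[A] U) (x : pts S) :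
    map (g.comp f) x = map g (map f x)
  map_smul {S T : Type u} [CommRing S] [Algebra A S] [CommRing T] [Algebra A T] (f : S →ₐ[A] T)
    (a : S) (x : pts S) : map f (a • x) = f a • map f x
  representable : ∃ (B : Type u) (_ : CommRing B) (_ : Algebra A B) (ξ : pts B),
    ∀ (S : Type u) [CommRing S] [Algebra A S] (x : pts S), ∃! f : B →ₐ[A] S, map f ξ = x
  point (S : Type u) [CommRing S] [Algebra A S] : pts S →ₗ[S] S
  point_map {S T : Type u} [CommRing S] [Algebra A S] [CommRing T] [Algebra A T] (f : S →ₐ[A] T)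
    (x : pts S) : point T (map f x) = f (point S x)

attribute [instance] PointedGaModule.grp PointedGaModule.mod

/-- A pointed `𝔾ₐ^perf`-module over an `𝔽_p`-algebra `A`: a presheaf of modules `S ↦ pts S` over
the presheaf of rings `𝔾ₐ^perf : S ↦ S^♭` on affine `A`-schemes, whose underlying presheaf of sets
is representable by an affine `A`-scheme, and a map of `𝔾ₐ^perf`-modules to `𝔾ₐ^perf`. -/
structure PointedGaPerfModule (p : ℕ) [Fact p.Prime] (A : Type u) [CommRing A]
    [Algebra (ZMod p) A] where
  pts (S : Type u) [CommRing S] [Algebra A S] : Type u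
  [grp (S : Type u) [CommRing S] [Algebra A S] : AddCommGroup (pts S)]
  [mod (S : Type u) [CommRing S] [Algebra A S] :
    Module (tilt p S (natCast_eq_zero_of_algebra p A S)) (pts S)]
  map {S T : Type u} [CommRing S] [Algebra A S] [CommRing T] [Algebra A T] (f : S →ₐ[A] T) :
    pts S →+ pts T
  map_id (S : Type u) [CommRing S] [Algebra A S] (x : pts S) : map (AlgHom.id A S) x = x
  map_comp {S T U : Type u} [CommRing S] [Algebra A S] [CommRing T] [Algebra A T]
    [CommRing U] [Algebra A U] (f : S →ₐ[A] T) (g : T →ₐ[A] U) (x : pts S) :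
    map (g.comp f) x = map g (map f x)
  map_smul {S T : Type u} [CommRing S] [Algebra A S] [CommRing T] [Algebra A T] (f : S →ₐ[A] T)
    (a : tilt p S (natCast_eq_zero_of_algebra p A S)) (x : pts S) :
    map f (a • x) = tiltMap p (natCast_eq_zero_of_algebra p A S)
      (natCast_eq_zero_of_algebra p A T) f.toRingHom a • map f x
  representable : ∃ (B : Type u) (_ : CommRing B) (_ : Algebra A B) (ξ : pts B),
    ∀ (S : Type u) [CommRing S] [Algebra A S] (x : pts S), ∃! f : B →ₐ[A] S, map f ξ = x
  point (S : Type u) [CommRing S] [Algebra A S] :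
    pts S →ₗ[tilt p S (natCast_eq_zero_of_algebra p A S)]
      tilt p S (natCast_eq_zero_of_algebra p A S)
  point_map {S T : Type u} [CommRing S] [Algebra A S] [CommRing T] [Algebra A T] (f : S →ₐ[A] T)
    (x : pts S) : point T (map f x) = tiltMap p (natCast_eq_zero_of_algebra p A S)
      (natCast_eq_zero_of_algebra p A T) f.toRingHom (point S x)

attribute [instance] PointedGaPerfModule.grp PointedGaPerfModule.mod

namespace PointedGaPerfModule

variable {p : ℕ} [Fact p.Prime]

section

variable {A : Type u} [CommRing A] [Algebra (ZMod p) A]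

/-- An isomorphism of pointed `𝔾ₐ^perf`-modules: a natural family of `S^♭`-linear bijections
commuting with the points. -/
@[ext]
structure Iso (X Y : PointedGaPerfModule.{u} p A) where
  app (S : Type u) [CommRing S] [Algebra A S] :
    X.pts S ≃ₗ[tilt p S (natCast_eq_zero_of_algebra p A S)] Y.pts S
  naturality {S T : Type u} [CommRing S] [Algebra A S] [CommRing T] [Algebra A T]
    (f : S →ₐ[A] T) (x : X.pts S) : app T (X.map f x) = Y.map f (app S x)
  point_app (S : Type u) [CommRing S] [Algebra A S] (x : X.pts S) :
    Y.point S (app S x) = X.point S x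

/-- The affine scheme underlying `X` is flat over `A`. -/
def IsFlat (X : PointedGaPerfModule.{u} p A) : Prop :=
  ∃ (B : Type u) (_ : CommRing B) (_ : Algebra A B) (ξ : X.pts B),
    (∀ (S : Type u) [CommRing S] [Algebra A S] (x : X.pts S),
      ∃! f : B →ₐ[A] S, X.map f ξ = x) ∧ Module.Flat A B

end

/-- Over a field every pointed `𝔾ₐ^perf`-module is flat. -/
theorem isFlat_of_field {k : Type u} [Field k] [Algebra (ZMod p) k]
    (X : PointedGaPerfModule.{u} p k) : X.IsFlat := by
  obtain ⟨B, i, j, ξ, h⟩ := X.representable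
  exact ⟨B, i, j, ξ, h, inferInstance⟩

end PointedGaPerfModule

/-! ### The pointed `𝔾ₐ`-module `W[F]` -/

/-- `W[F](S)`: the kernel of the Witt vector Frobenius on the `p`-typical Witt vectors `W(S)`. -/
def WittKer (p : ℕ) [Fact p.Prime] (S : Type u) [CommRing S] : Type u :=
  (RingHom.ker (WittVector.frobenius : WittVector p S →+* WittVector p S))

namespace WittKer

variable {p : ℕ} [Fact p.Prime] {S : Type u} [CommRing S]

noncomputable instance : AddCommGroup (WittKer p S) :=
  inferInstanceAs (AddCommGroup (RingHom.ker
    (WittVector.frobenius : WittVector p S →+* WittVector p S)))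

/-- The inclusion `W[F](S) ⊆ W(S)`. -/
noncomputable def val : WittKer p S →+ WittVector p S :=
  (Submodule.subtype (RingHom.ker
    (WittVector.frobenius : WittVector p S →+* WittVector p S))).toAddMonoidHom

theorem val_injective : Function.Injective (val : WittKer p S → WittVector p S) :=
  Subtype.val_injective

theorem frobenius_val (x : WittKer p S) : WittVector.frobenius (val x) = 0 := x.2

/-- An element of `W(S)` killed by Frobenius, as an element of `W[F](S)`. -/
def mk (w : WittVector p S) (h : WittVector.frobenius w = 0) : WittKer p S := ⟨w, h⟩

@[simp] theorem val_mk (w : WittVector p S) (h : WittVector.frobenius w = 0) :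
    val (mk w h) = w := rfl

/-- `V(W(S))`, the Witt vectors with vanishing zeroth component, annihilates `W[F](S)`. -/
theorem mul_val_eq_zero (v : WittVector p S) (hv : v.coeff 0 = 0) (x : WittKer p S) :
    v * val x = 0 := by
  have h : WittVector.verschiebung (v.shift 1) = v := by
    have := WittVector.verschiebung_shift v 0 (by
      intro i hi
      obtain rfl : i = 0 := by omega
      exact hv)
    rw [this]
    ext n
    simp [WittVector.shift_coeff]
  rw [← h, ← WittVector.verschiebung_mul_frobenius, frobenius_val, mul_zero, map_zero]

/-- `W(S)` acts on `W[F](S)` through `W(S) / V(W(S)) = S`; so `a : S` acts as any of its lifts to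
`W(S)`, for instance as the Teichmüller representative. -/
noncomputable instance : Module S (WittKer p S) where
  smul a x := mk (WittVector.teichmuller p a * val x) (by
    rw [map_mul, frobenius_val, mul_zero])
  one_smul x := val_injective (by
    change WittVector.teichmuller p 1 * val x = val x
    simp)
  mul_smul a b x := val_injective (by
    change WittVector.teichmuller p (a * b) * val x =
      WittVector.teichmuller p a * (WittVector.teichmuller p b * val x)
    rw [map_mul, mul_assoc])
  smul_zero a := val_injective (by
    change WittVector.teichmuller p a * val 0 = val 0
    simp)
  smul_add a x y := val_injective (by
    change WittVector.teichmuller p a * val (x + y) =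
      WittVector.teichmuller p a * val x + WittVector.teichmuller p a * val y
    rw [map_add, mul_add])
  add_smul a b x := val_injective (by
    change WittVector.teichmuller p (a + b) * val x =
      WittVector.teichmuller p a * val x + WittVector.teichmuller p b * val x
    rw [← sub_eq_zero, ← add_mul, ← sub_mul]
    apply mul_val_eq_zero
    have hc : ∀ w : WittVector p S,
        w.coeff 0 = (WittVector.constantCoeff : WittVector p S →+* S) w := fun _ => rfl
    rw [hc, map_sub, map_add (WittVector.constantCoeff : WittVector p S →+* S), ← hc, ← hc, ← hc]
    simp)
  zero_smul x := val_injective (by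
    change WittVector.teichmuller p 0 * val x = val 0
    simp)

theorem val_smul (a : S) (x : WittKer p S) :
    val (a • x) = WittVector.teichmuller p a * val x := rfl

/-- The map `W[F](S) → W[F](T)` induced by a ring homomorphism. -/
noncomputable def map {T : Type u} [CommRing T] (f : S →+* T) : WittKer p S →+ WittKer p T where
  toFun x := mk (WittVector.map f (val x)) (by
    rw [← WittVector.frobenius_isPoly p |>.map, frobenius_val, map_zero])
  map_zero' := val_injective (by simp)
  map_add' x y := val_injective (by simp)

theorem val_map {T : Type u} [CommRing T] (f : S →+* T) (x : WittKer p S) :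
    val (map f x) = WittVector.map f (val x) := rfl

end WittKer

/-- The pointed `𝔾ₐ`-module `W[F]` over `A`, with point `W[F](S) → S` the zeroth component. -/
noncomputable def wittFrobeniusKernel (p : ℕ) [Fact p.Prime] (A : Type u) [CommRing A] :
    PointedGaModule.{u} A where
  pts S _ _ := WittKer p S
  map f := WittKer.map f.toRingHom
  map_id S _ _ x := WittKer.val_injective (by
    ext n
    simp [WittKer.val_map])
  map_comp f g x := WittKer.val_injective (by
    ext n
    simp [WittKer.val_map, WittVector.map_coeff])
  map_smul f a x := WittKer.val_injective (by
    simp [WittKer.val_map, WittKer.val_smul, WittVector.map_teichmuller])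
  representable := by
    let I : Ideal (MvPolynomial ℕ A) := Ideal.span (Set.range fun n =>
      MvPolynomial.map (Int.castRingHom A) (WittVector.frobeniusPoly p n))
    have key : ∀ (S : Type u) [CommRing S] [Algebra A S] (g : MvPolynomial ℕ A →ₐ[A] S) (n : ℕ),
        g (MvPolynomial.map (Int.castRingHom A) (WittVector.frobeniusPoly p n)) =
          (WittVector.frobenius (WittVector.mk p fun i => g (MvPolynomial.X i))).coeff n := by
      intro S _ _ g n
      rw [WittVector.coeff_frobenius]
      have h : (g : MvPolynomial ℕ A →+* S).comp (MvPolynomial.map (Int.castRingHom A)) =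
          (MvPolynomial.aeval fun i => g (MvPolynomial.X i) :
            MvPolynomial ℕ ℤ →ₐ[ℤ] S).toRingHom := by
        apply MvPolynomial.ringHom_ext
        · intro r; simp
        · intro i; simp
      exact congrArg (fun φ : MvPolynomial ℕ ℤ →+* S => φ (WittVector.frobeniusPoly p n)) h
    refine ⟨MvPolynomial ℕ A ⧸ I, inferInstance, inferInstance,
      WittKer.mk (WittVector.mk p fun i => Ideal.Quotient.mkₐ A I (MvPolynomial.X i)) ?_, ?_⟩
    · ext n
      rw [← key, WittVector.zero_coeff]
      exact Ideal.Quotient.eq_zero_iff_mem.2 (Ideal.subset_span ⟨n, rfl⟩)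
    · intro S _ _ x
      let g : MvPolynomial ℕ A →ₐ[A] S := MvPolynomial.aeval fun i => (WittKer.val x).coeff i
      have hg : ∀ a ∈ I, g a = 0 := by
        intro a ha
        have : I ≤ RingHom.ker g := by
          rw [Ideal.span_le]
          rintro _ ⟨n, rfl⟩
          change g _ = 0
          rw [key]
          have : (WittVector.mk p fun i => g (MvPolynomial.X i)) = WittKer.val x := by
            ext i
            simp [g]
          rw [this, WittKer.frobenius_val, WittVector.zero_coeff]
        exact this ha
      refine ⟨Ideal.Quotient.liftₐ I g hg, WittKer.val_injective ?_, ?_⟩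
      · ext n
        change MvPolynomial.aeval (fun i => (WittKer.val x).coeff i) (MvPolynomial.X n) = _
        simp
      · intro f hf
        apply Ideal.Quotient.algHom_ext
        apply MvPolynomial.algHom_ext
        intro i
        have h := congrArg (fun y => (WittKer.val y).coeff i) hf
        change f (Ideal.Quotient.mk I (MvPolynomial.X i)) = _ at h
        refine h.trans ?_
        change _ = MvPolynomial.aeval (fun i => (WittKer.val x).coeff i) (MvPolynomial.X i)
        simp
  point S _ _ :=
    { toFun := fun x => (WittKer.val x).coeff 0
      map_add' := fun x y => by
        rw [map_add]
        exact map_add (WittVector.constantCoeff : WittVector p S →+* S) _ _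
      map_smul' := fun a x => by
        rw [WittKer.val_smul]
        exact (map_mul (WittVector.constantCoeff : WittVector p S →+* S) _ _).trans
          (by simp [WittVector.constantCoeff]) }
  point_map f x := by simp [WittKer.val_map, WittVector.map_coeff]

/-! ### The pullback `u^*` -/

/-- The `S`-points of the pullback `u^* X = X ×_{𝔾ₐ} 𝔾ₐ^perf` of a pointed `𝔾ₐ`-module `X`:
`{(x, a) ∈ X(S) × S^♭ : the point of X sends x to u(a)}`. -/
def pullbackPts (p : ℕ) [Fact p.Prime] {A : Type u} [CommRing A] [Algebra (ZMod p) A]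
    (X : PointedGaModule.{u} A) (S : Type u) [CommRing S] [Algebra A S] :
    AddSubgroup (X.pts S × tilt p S (natCast_eq_zero_of_algebra p A S)) where
  carrier := {z | X.point S z.1 = untilt p S (natCast_eq_zero_of_algebra p A S) z.2}
  zero_mem' := by simp
  add_mem' {z w} hz hw := by
    change X.point S (z.1 + w.1) = untilt p S _ (z.2 + w.2)
    rw [map_add, map_add, hz, hw]
  neg_mem' {z} hz := by
    change X.point S (-z.1) = untilt p S _ (-z.2)
    rw [map_neg, map_neg, hz]

namespace pullbackPts

variable {p : ℕ} [Fact p.Prime] {A : Type u} [CommRing A] [Algebra (ZMod p) A]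
  {X : PointedGaModule.{u} A} {S : Type u} [CommRing S] [Algebra A S]

theorem ext {z w : pullbackPts p X S} (h₁ : z.1.1 = w.1.1) (h₂ : z.1.2 = w.1.2) : z = w :=
  Subtype.ext (Prod.ext h₁ h₂)

/-- `S^♭` acts on `X(S)` through `u : S^♭ → S`, and on `S^♭` by multiplication. -/
instance : Module (tilt p S (natCast_eq_zero_of_algebra p A S)) (pullbackPts p X S) where
  smul a z := ⟨(untilt p S (natCast_eq_zero_of_algebra p A S) a • z.1.1, a * z.1.2), by
    change X.point S (untilt p S _ a • z.1.1) = untilt p S _ (a * z.1.2)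
    rw [map_smul, map_mul, smul_eq_mul, (z.2 : X.point S z.1.1 = untilt p S _ z.1.2)]⟩
  one_smul z := pullbackPts.ext
    (show untilt p S (natCast_eq_zero_of_algebra p A S) 1 • z.1.1 = _ by rw [map_one, one_smul])
    (one_mul _)
  mul_smul a b z := pullbackPts.ext
    (show untilt p S (natCast_eq_zero_of_algebra p A S) (a * b) • z.1.1 = _ by
      rw [map_mul, mul_smul]; rfl)
    (mul_assoc _ _ _)
  smul_zero a := pullbackPts.ext (smul_zero _) (mul_zero _)
  smul_add a z w := pullbackPts.ext (smul_add _ _ _) (mul_add _ _ _)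
  add_smul a b z := pullbackPts.ext
    (show untilt p S (natCast_eq_zero_of_algebra p A S) (a + b) • z.1.1 = _ by
      rw [map_add, add_smul]; rfl)
    (add_mul _ _ _)
  zero_smul z := pullbackPts.ext
    (show untilt p S (natCast_eq_zero_of_algebra p A S) 0 • z.1.1 = _ by rw [map_zero, zero_smul]; rfl)
    (zero_mul _)

end pullbackPts

/-- The functor `u^*` on objects: the pointed `𝔾ₐ^perf`-module `u^* X = X ×_{𝔾ₐ} 𝔾ₐ^perf`, with
point the projection to `𝔾ₐ^perf`. -/
def PointedGaModule.pullback (p : ℕ) [Fact p.Prime] {A : Type u} [CommRing A]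
    [Algebra (ZMod p) A] (X : PointedGaModule.{u} A) : PointedGaPerfModule.{u} p A where
  pts S _ _ := pullbackPts p X S
  grp S _ _ := inferInstance
  mod S _ _ := inferInstance
  map {S T} _ _ _ _ f :=
    { toFun := fun z => ⟨(X.map f z.1.1, tiltMap p (natCast_eq_zero_of_algebra p A S)
        (natCast_eq_zero_of_algebra p A T) f.toRingHom z.1.2), by
          exact (X.point_map f z.1.1).trans (congrArg f z.2)⟩
      map_zero' := pullbackPts.ext (map_zero _) (map_zero _)
      map_add' := fun z w => pullbackPts.ext (map_add _ _ _) (map_add _ _ _) }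
  map_id S _ _ x := pullbackPts.ext (X.map_id S _) rfl
  map_comp f g x := pullbackPts.ext (X.map_comp f g _) rfl
  map_smul f a x := pullbackPts.ext (X.map_smul f _ _) (map_mul _ _ _)
  representable := by
    obtain ⟨B, _, _, ξ, hξ⟩ := X.representable
    let I : Ideal (MvPolynomial ℕ B) := Ideal.span (insert
      (MvPolynomial.X 0 - MvPolynomial.C (X.point B ξ))
      (Set.range fun n => MvPolynomial.X (n + 1) ^ p - MvPolynomial.X n))
    let ι : B →ₐ[A] MvPolynomial ℕ B ⧸ I :=
      (Ideal.Quotient.mkₐ A I).comp (Algebra.algHom A B (MvPolynomial ℕ B))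
    have hX (n : ℕ) : (Ideal.Quotient.mk I (MvPolynomial.X (n + 1))) ^ p =
        Ideal.Quotient.mk I (MvPolynomial.X n) := by
      rw [← map_pow, Ideal.Quotient.eq]
      exact Ideal.subset_span (Or.inr ⟨n, rfl⟩)
    have hX0 : ι (X.point B ξ) = Ideal.Quotient.mk I (MvPolynomial.X 0) := by
      symm
      exact Ideal.Quotient.eq.2 (Ideal.subset_span (Or.inl rfl))
    refine ⟨MvPolynomial ℕ B ⧸ I, inferInstance, inferInstance,
      ⟨(X.map ι ξ, ⟨fun n => Ideal.Quotient.mk I (MvPolynomial.X n), hX⟩), ?_⟩, ?_⟩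
    · exact (X.point_map ι ξ).trans hX0
    · intro S _ _ z
      obtain ⟨f, hf, hfu⟩ := hξ S z.1.1
      let g : MvPolynomial ℕ B →+* S := MvPolynomial.eval₂Hom f.toRingHom fun n => z.1.2.1 n
      have hg : ∀ a ∈ I, g a = 0 := by
        intro a ha
        have : I ≤ RingHom.ker g := by
          rw [Ideal.span_le]
          rintro _ (rfl | ⟨n, rfl⟩)
          · change g _ = 0
            have h : X.point S z.1.1 = z.1.2.1 0 := z.2
            rw [← hf, X.point_map] at h
            rw [map_sub, sub_eq_zero]
            simp only [g, MvPolynomial.coe_eval₂Hom, MvPolynomial.eval₂_X, MvPolynomial.eval₂_C]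
            exact h.symm
          · change g _ = 0
            rw [map_sub, map_pow, sub_eq_zero]
            simp only [g, MvPolynomial.coe_eval₂Hom, MvPolynomial.eval₂_X]
            exact z.1.2.2 n
        exact this ha
      let G : MvPolynomial ℕ B ⧸ I →ₐ[A] S :=
        { Ideal.Quotient.lift I g hg with
          commutes' := fun a => by
            change g (MvPolynomial.C (algebraMap A B a)) = _
            simp [g] }
      have hGι : G.comp ι = f := by
        ext b
        change g (MvPolynomial.C b) = f b
        simp [g]
      refine ⟨G, pullbackPts.ext ?_ ?_, ?_⟩
      · change X.map G (X.map ι ξ) = _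
        rw [← X.map_comp, hGι, hf]
      · ext n
        change g (MvPolynomial.X n) = _
        simp [g]
      · intro h hh
        have h1 : X.map h (X.map ι ξ) = z.1.1 := congrArg (fun w => w.1.1) hh
        have h2 (n : ℕ) : h (Ideal.Quotient.mk I (MvPolynomial.X n)) = z.1.2.1 n :=
          congrArg (fun w => w.1.2.1 n) hh
        have h3 : h.comp ι = f := hfu _ ((X.map_comp ι h ξ).trans h1)
        have h4 : (h : MvPolynomial ℕ B ⧸ I →+* S) = (G : MvPolynomial ℕ B ⧸ I →+* S) := by
          apply Ideal.Quotient.ringHom_ext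
          apply MvPolynomial.ringHom_ext
          · intro b
            exact (AlgHom.congr_fun h3 b).trans (AlgHom.congr_fun hGι b).symm
          · intro n
            refine (h2 n).trans ?_
            change _ = g (MvPolynomial.X n)
            simp [g]
        exact AlgHom.ext fun b => RingHom.congr_fun h4 b
  point S _ _ :=
    { toFun := fun z => z.1.2
      map_add' := fun _ _ => rfl
      map_smul' := fun _ _ => rfl }
  point_map f x := rfl

/-! ### Base change and deformations -/

namespace PointedGaPerfModule

variable {p : ℕ} [Fact p.Prime]

section

variable {A A' : Type u} [CommRing A] [Algebra (ZMod p) A] [CommRing A']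

/-- An `A'`-algebra map, regarded as a map of `A`-algebras along `f : A → A'`. -/
def restrictHom (f : A →+* A') {S T : Type u} [CommRing S] [Algebra A' S]
    [CommRing T] [Algebra A' T] (g : S →ₐ[A'] T) :
    letI := Algebra.compHom S f
    letI := Algebra.compHom T f
    S →ₐ[A] T :=
  letI := Algebra.compHom S f
  letI := Algebra.compHom T f
  { g.toRingHom with commutes' := fun a => g.commutes (f a) }

/-- If `ξ ∈ X(B)` is a universal point, then its image in `X(A' ⊗[A] B)` is a universal point of
the restriction of `X` to `A'`-algebras. -/
theorem exists_universal_baseChange (f : A →+* A') (X : PointedGaPerfModule.{u} p A)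
    (B : Type u) [CommRing B] [Algebra A B] (ξ : X.pts B)
    (hξ : ∀ (S : Type u) [CommRing S] [Algebra A S] (x : X.pts S),
      ∃! g : B →ₐ[A] S, X.map g ξ = x) :
    letI := f.toAlgebra
    ∃ η : (letI := Algebra.compHom (TensorProduct A A' B) f; X.pts (TensorProduct A A' B)),
      ∀ (S : Type u) [CommRing S] [Algebra A' S] (x : letI := Algebra.compHom S f; X.pts S),
        ∃! g : TensorProduct A A' B →ₐ[A'] S,
          letI := Algebra.compHom (TensorProduct A A' B) f
          letI := Algebra.compHom S f
          X.map (restrictHom f g) η = x := by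
  let := f.toAlgebra
  let iT : Algebra A (TensorProduct A A' B) := Algebra.compHom (TensorProduct A A' B) f
  let ι : @AlgHom A B (TensorProduct A A' B) _ _ _ _ iT :=
    { (Algebra.TensorProduct.includeRight : B →ₐ[A] TensorProduct A A' B).toRingHom with
      commutes' := fun a => by
        change (1 : A') ⊗ₜ[A] (algebraMap A B a) = (f a) ⊗ₜ[A] (1 : B)
        rw [Algebra.algebraMap_eq_smul_one, ← TensorProduct.smul_tmul, Algebra.smul_def, mul_one]
        rfl }
  refine ⟨X.map ι ξ, ?_⟩
  intro S _ _ x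
  let iS : Algebra A S := Algebra.compHom S f
  have : IsScalarTower A A' S := IsScalarTower.of_algebraMap_eq fun _ => rfl
  obtain ⟨g, hg, hgu⟩ := hξ S x
  have hι : ∀ h : TensorProduct A A' B →ₐ[A'] S, ∀ b, ((restrictHom f h).comp ι) b =
      h ((1 : A') ⊗ₜ[A] b) := fun _ _ => rfl
  refine ⟨Algebra.TensorProduct.lift (Algebra.ofId A' S) g (fun _ _ => Commute.all _ _), ?_, ?_⟩
  · change X.map _ (X.map ι ξ) = x
    rw [← X.map_comp, ← hg]
    congr 1
    congr 1
    ext b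
    rw [hι]
    simp
  · intro h hh
    change X.map _ (X.map ι ξ) = x at hh
    rw [← X.map_comp] at hh
    have := hgu _ hh
    apply Algebra.TensorProduct.ext
    · ext
    · ext b
      have h2 := (hι h b).symm.trans (AlgHom.congr_fun this b)
      simpa using h2

variable [Algebra (ZMod p) A']

/-- The base change `X ⊗_A A'` along `f : A → A'`. Its points in an `A'`-algebra `S` are the points
of `X` in `S` regarded as an `A`-algebra. -/
def baseChange (f : A →+* A') (X : PointedGaPerfModule.{u} p A) :
    PointedGaPerfModule.{u} p A' where
  pts S _ _ := letI := Algebra.compHom S f; X.pts S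
  grp S _ _ := letI := Algebra.compHom S f; X.grp S
  mod S _ _ := letI := Algebra.compHom S f; X.mod S
  map {S T} _ _ _ _ g :=
    letI := Algebra.compHom S f
    letI := Algebra.compHom T f
    X.map (restrictHom f g)
  map_id S _ _ x := letI := Algebra.compHom S f; X.map_id S x
  map_comp {S T U} _ _ _ _ _ _ g h x :=
    letI := Algebra.compHom S f
    letI := Algebra.compHom T f
    letI := Algebra.compHom U f
    X.map_comp (restrictHom f g) (restrictHom f h) x
  map_smul {S T} _ _ _ _ g a x :=
    letI := Algebra.compHom S f
    letI := Algebra.compHom T f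
    X.map_smul (restrictHom f g) a x
  representable := by
    obtain ⟨B, _, _, ξ, hξ⟩ := X.representable
    let := f.toAlgebra
    obtain ⟨η, hη⟩ := exists_universal_baseChange f X B ξ hξ
    exact ⟨TensorProduct A A' B, inferInstance, inferInstance, η, hη⟩
  point S _ _ := letI := Algebra.compHom S f; X.point S
  point_map {S T} _ _ _ _ g x :=
    letI := Algebra.compHom S f
    letI := Algebra.compHom T f
    X.point_map (restrictHom f g) x

theorem IsFlat.baseChange (f : A →+* A') {X : PointedGaPerfModule.{u} p A} (hX : X.IsFlat) :
    (X.baseChange f).IsFlat := by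
  obtain ⟨B, _, _, ξ, hξ, hB⟩ := hX
  let := f.toAlgebra
  obtain ⟨η, hη⟩ := exists_universal_baseChange f X B ξ hξ
  exact ⟨TensorProduct A A' B, inferInstance, inferInstance, η, hη, inferInstance⟩

/-- For a section `g` of a ring map `f : A' → A`, the canonical isomorphism
`(X ⊗_A A') ⊗_{A'} A ≅ X`; on points it is induced by the identity of `S`. -/
def baseChangeRetract (f : A' →+* A) (g : A →+* A') (h : f.comp g = RingHom.id A)
    (X : PointedGaPerfModule.{u} p A) : Iso ((X.baseChange g).baseChange f) X where
  app S _ iS :=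
    letI i₁ : Algebra A' S := Algebra.compHom S f
    letI i₂ : Algebra A S := Algebra.compHom S g
    have e : ∀ a, @algebraMap A S _ _ i₂ a = @algebraMap A S _ _ iS a := fun a =>
      congrArg (@algebraMap A S _ _ iS) (RingHom.congr_fun h a)
    let u : @AlgHom A S S _ _ _ i₂ iS := @AlgHom.mk A S S _ _ _ i₂ iS (RingHom.id S) e
    let v : @AlgHom A S S _ _ _ iS i₂ :=
      @AlgHom.mk A S S _ _ _ iS i₂ (RingHom.id S) fun a => (e a).symm
    { toFun := fun x => @map p _ A _ _ X S S _ i₂ _ iS u x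
      invFun := fun x => @map p _ A _ _ X S S _ iS _ i₂ v x
      map_add' := fun x y => map_add (@map p _ A _ _ X S S _ i₂ _ iS u) x y
      map_smul' := fun a x => @map_smul p _ A _ _ X S S _ i₂ _ iS u a x
      left_inv := fun x => (@map_comp p _ A _ _ X S S S _ i₂ _ iS _ i₂ u v x).symm.trans
        (@map_id p _ A _ _ X S _ i₂ x)
      right_inv := fun x => (@map_comp p _ A _ _ X S S S _ iS _ i₂ _ iS v u x).symm.trans
        (@map_id p _ A _ _ X S _ iS x) }
  naturality {S T} _ iS _ iT k x := by
    let j₁ : Algebra A' S := Algebra.compHom S f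
    let i₂ : Algebra A S := Algebra.compHom S g
    let l₁ : Algebra A' T := Algebra.compHom T f
    let l₂ : Algebra A T := Algebra.compHom T g
    exact (@map_comp p _ A _ _ X S T T _ i₂ _ l₂ _ iT _ _ x).symm.trans
      (@map_comp p _ A _ _ X S S T _ i₂ _ iS _ iT (@AlgHom.mk A S S _ _ _ i₂ iS (RingHom.id S)
        fun a => congrArg (@algebraMap A S _ _ iS) (RingHom.congr_fun h a)) k x)
  point_app S _ iS x := by
    let j₁ : Algebra A' S := Algebra.compHom S f
    let i₂ : Algebra A S := Algebra.compHom S g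
    exact @point_map p _ A _ _ X S S _ i₂ _ iS _ x

/-- A deformation of `X₀` along `f : A' → A`: a pointed `𝔾ₐ^perf`-module `X` over `A'`, flat over
`A'`, with an isomorphism of its base change to `A` with `X₀`. -/
structure Deformation (f : A' →+* A) (X₀ : PointedGaPerfModule.{u} p A) where
  X : PointedGaPerfModule.{u} p A'
  flat : X.IsFlat
  iso : Iso (X.baseChange f) X₀

namespace Deformation

variable {f : A' →+* A} {X₀ : PointedGaPerfModule.{u} p A}

/-- The trivial deformation of `X₀` along a ring map `f : A' → A` with a section `g`: the base
change of `X₀` along `g`. -/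
def trivial (f : A' →+* A) (g : A →+* A') (h : f.comp g = RingHom.id A)
    (X₀ : PointedGaPerfModule.{u} p A) (hX₀ : X₀.IsFlat) : Deformation f X₀ where
  X := X₀.baseChange g
  flat := hX₀.baseChange g
  iso := baseChangeRetract f g h X₀

/-- An isomorphism `φ : D.X ≅ E.X` is an isomorphism of deformations if its base change along `f`
is compatible with the identifications with `X₀`. -/
def IsCompatible (D E : Deformation f X₀) (φ : Iso D.X E.X) : Prop :=
  ∀ (S : Type u) [CommRing S] [Algebra A S] (x : (D.X.baseChange f).pts S),
    E.iso.app S (letI := Algebra.compHom S f; φ.app S x) = D.iso.app S x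

end Deformation

end

end PointedGaPerfModule

/-! ### `u^* W[F]` and its trivial deformation over the dual numbers -/

/-- The pointed `𝔾ₐ^perf`-module `u^* W[F]` over `𝔽_p`. -/
noncomputable def perfWittFrobeniusKernel (p : ℕ) [Fact p.Prime] :
    PointedGaPerfModule p (ZMod p) :=
  (wittFrobeniusKernel p (ZMod p)).pullback p

/-- The reduction `𝔽_p[ε]/ε² → 𝔽_p`, `ε ↦ 0`. -/
def dualNumberReduction (p : ℕ) : DualNumber (ZMod p) →+* ZMod p :=
  (TrivSqZeroExt.fstHom (ZMod p) (ZMod p) (ZMod p)).toRingHom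

/-- The trivial deformation `u^* W[F] ⊗ 𝔽_p[ε]/ε²` of `u^* W[F]`. -/
noncomputable def trivialDeformation (p : ℕ) [Fact p.Prime] :
    PointedGaPerfModule.Deformation (dualNumberReduction p) (perfWittFrobeniusKernel p) :=
  PointedGaPerfModule.Deformation.trivial (dualNumberReduction p)
    (algebraMap (ZMod p) (DualNumber (ZMod p))) (RingHom.ext fun _ => rfl)
    (perfWittFrobeniusKernel p) (PointedGaPerfModule.isFlat_of_field _)

/-! Write Q = ℤ[1/p]_{≥ 0}. For X = Spec B, the action of 𝔾ₐ^perf is a grading of B by Q, addition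
gives a cocommutative comultiplication that respects this grading, and the point supplies elements
a^q of degree q. For u^*W[F] every graded piece has rank one: the Witt component x_i has degree p^i,
x_0 = a_0 and x_i^p = 0, so the monomials a^{fract q} ∏ x_i^{e_i}, with e_i the base p digits of the
integral part of q, form a basis. By flatness a deformation also has a homogeneous basis (b_q), with
b_q = a^q for q ≤ 1.

Such a B is rigid. Let c_q be the coordinate functionals; under convolution c_i c_j = λ_{ij}
c_{i+j}. Comparing coefficients in (s + t)x = sx + tx gives binom(u+v, u) b_{(u+v)/p^n} = λ
b_{u/p^n} b_{v/p^n} (`choose_smul_basis`), so λ is a unit whenever the binomial coefficient is. By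
Lucas this covers an integer plus a fraction below 1, and a suitable splitting of every positive
integer that is not a power of p. If two nonzero degrees add up to 1, then λ = 0, because a_0 is
additive. In degree p^n with n ≥ 1 some λ must be a unit: otherwise all of them would vanish modulo
ε, and the component x_n would be additive on W[F], which fails by the first carry in Witt vector
addition (`exists_coeff_add_ne`).

Hence c_1^m is a unit multiple of c_m for all m (`exists_coord_one_pow`). The elements γ_m dual to
c_1^m are divided powers of a_0, and the products γ_{floor q} a^{fract q} form a basis of B. This
identifies X with u^*𝔾ₐ^♯, the module of divided power sequences (`isUniversal_dividedPowers`). The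
same applies to the trivial deformation, so the two are isomorphic.

A homomorphism X → u^*𝔾ₐ^♯ is unique: its m-th component is homogeneous of degree m and takes the
value 1 under c_1^m (`dp_unique`). Over the dual numbers this gives uniqueness of the isomorphism;
on the special fibre it gives compatibility with ι. -/

/-! ### Exponents in ℤ[1/p]_{≥ 0}, with integral and fractional parts. -/

/-- The additive monoid `ℤ[1/p]_{≥ 0}`. -/
def NonnegPAdicFrac (p : ℕ) : AddSubmonoid ℚ≥0 where
  carrier := {q | ∃ n m : ℕ, q * (p : ℚ≥0) ^ n = m}
  zero_mem' := ⟨0, 0, by simp⟩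
  add_mem' := by
    rintro q r ⟨n, m, h⟩ ⟨n', m', h'⟩
    refine ⟨n + n', m * p ^ n' + m' * p ^ n, ?_⟩
    push_cast
    rw [← h, ← h']
    ring

namespace NonnegPAdicFrac

variable {p : ℕ} [hp : Fact p.Prime]

/-- The fraction `m / p ^ n`. -/
def frac (p : ℕ) [hp : Fact p.Prime] (m n : ℕ) : NonnegPAdicFrac p :=
  ⟨m / (p : ℚ≥0) ^ n, n, m, div_mul_cancel₀ _ (pow_ne_zero _ (by exact_mod_cast hp.out.ne_zero))⟩

theorem pow_ne_zero' (n : ℕ) : ((p : ℚ≥0) ^ n) ≠ 0 :=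
  pow_ne_zero _ (by exact_mod_cast hp.out.ne_zero)

theorem frac_eq_frac {m n m' n' : ℕ} : frac p m n = frac p m' n' ↔ m * p ^ n' = m' * p ^ n := by
  rw [Subtype.ext_iff]
  change (m : ℚ≥0) / (p : ℚ≥0) ^ n = m' / (p : ℚ≥0) ^ n' ↔ _
  rw [div_eq_div_iff (pow_ne_zero' n) (pow_ne_zero' n')]
  exact_mod_cast Iff.rfl

theorem frac_mul_pow (m n k : ℕ) : frac p (m * p ^ k) (n + k) = frac p m n := by
  rw [frac_eq_frac]; ring

theorem frac_add_frac (m m' n : ℕ) : frac p m n + frac p m' n = frac p (m + m') n :=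
  Subtype.ext (by change (m : ℚ≥0) / _ + m' / _ = (m + m' : ℕ) / _; push_cast; rw [add_div])

theorem frac_zero (n : ℕ) : frac p 0 n = 0 := Subtype.ext (by change ((0 : ℕ) : ℚ≥0) / _ = 0; simp)

theorem nsmul_frac (k m n : ℕ) : k • frac p m n = frac p (k * m) n :=
  Subtype.ext (by
    change k • ((m : ℚ≥0) / _) = ((k * m : ℕ) : ℚ≥0) / _
    rw [nsmul_eq_mul]; push_cast; rw [mul_div_assoc])

theorem exists_eq_frac (q : NonnegPAdicFrac p) : ∃ m n, q = frac p m n := by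
  obtain ⟨q, n, m, h⟩ := q
  exact ⟨m, n, Subtype.ext (eq_div_of_mul_eq (pow_ne_zero' n) h)⟩

theorem exists_eq_frac₂ (q r : NonnegPAdicFrac p) : ∃ m m' n, q = frac p m n ∧ r = frac p m' n := by
  obtain ⟨m, n, rfl⟩ := exists_eq_frac q
  obtain ⟨m', n', rfl⟩ := exists_eq_frac r
  refine ⟨m * p ^ n', m' * p ^ n, n + n', (frac_mul_pow _ _ _).symm, ?_⟩
  rw [add_comm, frac_mul_pow]

/-- The natural number `m` as an element of `ℤ[1/p]_{≥ 0}`. -/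
def nat (p : ℕ) [Fact p.Prime] (m : ℕ) : NonnegPAdicFrac p := frac p m 0

theorem coe_nat (m : ℕ) : (nat p m : ℚ≥0) = m := by
  change (m : ℚ≥0) / (p : ℚ≥0) ^ 0 = m
  simp

theorem nat_injective : Function.Injective (nat p) := fun m m' h => by
  have := frac_eq_frac.1 h
  simpa using this

theorem nat_add (m m' : ℕ) : nat p (m + m') = nat p m + nat p m' := (frac_add_frac _ _ _).symm

theorem nat_zero : nat p 0 = 0 := frac_zero 0

theorem nat_eq_frac (m n : ℕ) : nat p m = frac p (m * p ^ n) n := by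
  rw [nat, ← frac_mul_pow m 0 n, zero_add]

/-- The integral part. -/
noncomputable def floor (q : NonnegPAdicFrac p) : ℕ := ⌊(q : ℚ≥0)⌋₊

/-- The fractional part. -/
noncomputable def fract (q : NonnegPAdicFrac p) : NonnegPAdicFrac p :=
  ⟨(q : ℚ≥0) - floor q, by
    obtain ⟨q, n, m, h⟩ := q
    refine ⟨n, m - ⌊q⌋₊ * p ^ n, ?_⟩
    change (q - (⌊q⌋₊ : ℚ≥0)) * _ = _
    rw [tsub_mul, h, Nat.cast_tsub]
    push_cast
    rfl⟩

theorem nat_floor_add_fract (q : NonnegPAdicFrac p) : nat p (floor q) + fract q = q :=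
  Subtype.ext (by
    change (nat p (floor q) : ℚ≥0) + (q - floor q : ℚ≥0) = q
    rw [coe_nat]
    exact add_tsub_cancel_of_le (Nat.floor_le zero_le))

theorem fract_lt_one (q : NonnegPAdicFrac p) : (fract q : ℚ≥0) < 1 := by
  have h := congrArg Subtype.val (nat_floor_add_fract q)
  have h' : (nat p (floor q) : ℚ≥0) + fract q = q := h
  rw [coe_nat] at h'
  have := Nat.lt_floor_add_one (q : ℚ≥0)
  change (q : ℚ≥0) < (floor q : ℚ≥0) + 1 at this
  rw [← h'] at this
  exact (add_lt_add_iff_left _).1 this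

theorem floor_nat_add {m : ℕ} {r : NonnegPAdicFrac p} (hr : (r : ℚ≥0) < 1) :
    floor (nat p m + r) = m := by
  change ⌊(nat p m : ℚ≥0) + r⌋₊ = m
  rw [coe_nat, add_comm, Nat.floor_add_natCast zero_le, Nat.floor_eq_zero.2 hr, zero_add]

theorem fract_nat_add {m : ℕ} {r : NonnegPAdicFrac p} (hr : (r : ℚ≥0) < 1) :
    fract (nat p m + r) = r := by
  have h := nat_floor_add_fract (nat p m + r)
  rw [floor_nat_add hr] at h
  exact add_left_cancel h

theorem floor_nat (m : ℕ) : floor (nat p m) = m := by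
  simpa using floor_nat_add (p := p) (m := m) (r := 0) (by simp)

theorem fract_nat (m : ℕ) : fract (nat p m) = 0 := by
  simpa using fract_nat_add (p := p) (m := m) (r := 0) (by simp)

theorem exists_frac_of_lt_one {r : NonnegPAdicFrac p} (hr : (r : ℚ≥0) < 1) :
    ∃ c n, c < p ^ n ∧ r = frac p c n := by
  obtain ⟨c, n, rfl⟩ := exists_eq_frac r
  refine ⟨c, n, ?_, rfl⟩
  change (c : ℚ≥0) / (p : ℚ≥0) ^ n < 1 at hr
  rw [div_lt_one (pos_of_ne_zero (pow_ne_zero' n))] at hr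
  exact_mod_cast hr

/-- Two fractional parts that add up to an integer either vanish or add up to `1`. -/
theorem fract_add_fract {i j : NonnegPAdicFrac p} {m : ℕ} (h : i + j = nat p m) :
    (fract i = 0 ∧ fract j = 0 ∧ floor i + floor j = m) ∨
      (fract i ≠ 0 ∧ fract i + fract j = nat p 1 ∧ floor i + floor j + 1 = m) := by
  have hi := nat_floor_add_fract i
  have hj := nat_floor_add_fract j
  have h' : nat p (floor i + floor j) + (fract i + fract j) = nat p m := by
    rw [← h, nat_add]
    nth_rewrite 3 [← hi]
    nth_rewrite 3 [← hj]
    abel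
  have hc : ((floor i + floor j : ℕ) : ℚ≥0) + (fract i + fract j : ℚ≥0) = m := by
    rw [← coe_nat (p := p), ← coe_nat (p := p)]
    exact congrArg Subtype.val h'
  have h1 := fract_lt_one i
  have h2 := fract_lt_one j
  by_cases h0 : fract i = 0
  · left
    have h3 : nat p (floor i + floor j) + fract j = nat p m := by rw [← h', h0, zero_add]
    have h4 : floor i + floor j = m := by
      rw [← floor_nat_add (m := floor i + floor j) h2, h3, floor_nat]
    refine ⟨h0, ?_, h4⟩
    rw [← fract_nat_add (m := floor i + floor j) h2, h3, fract_nat]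
  · right
    have hpos : (0 : ℚ≥0) < fract i := pos_of_ne_zero fun h => h0 (Subtype.ext h)
    -- The sum of the fractional parts is an integer strictly between 0 and 2, hence 1.
    have hlt : ((m : ℕ) : ℚ≥0) < (floor i + floor j + 2 : ℕ) := by
      rw [← hc]
      push_cast
      have := add_lt_add h1 h2
      rw [one_add_one_eq_two] at this
      exact (add_lt_add_iff_left _).2 this
    have hgt : ((floor i + floor j : ℕ) : ℚ≥0) < m := by
      rw [← hc]
      exact lt_add_of_pos_right _ (add_pos_of_pos_of_nonneg hpos zero_le)
    have hlt' : m < floor i + floor j + 2 := by exact_mod_cast hlt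
    have hgt' : floor i + floor j < m := by exact_mod_cast hgt
    have hm : floor i + floor j + 1 = m := by omega
    refine ⟨h0, ?_, hm⟩
    rw [← hm, nat_add _ 1] at h'
    exact add_left_cancel h'

end NonnegPAdicFrac

/-! ### Fractional powers of elements of the tilt. -/

section rpow

open NonnegPAdicFrac

variable {p : ℕ} [hp : Fact p.Prime] {S T : Type u} [CommRing S] [CommRing T]
  {hS : (p : S) = 0} {hT : (p : T) = 0}

theorem tilt_pow_pow (a : tilt p S hS) (n k : ℕ) : a.1 (n + k) ^ p ^ k = a.1 n := by
  induction k with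
  | zero => simp
  | succ k ih => rw [pow_succ', pow_mul, ← add_assoc, a.2, ih]

/-- The power `a ^ q ∈ S` of `a ∈ S^♭` with exponent `q ∈ ℤ[1/p]_{≥ 0}`. -/
noncomputable def tiltPow (a : tilt p S hS) (q : NonnegPAdicFrac p) : S :=
  a.1 (exists_eq_frac q).choose_spec.choose ^ (exists_eq_frac q).choose

/-- Independence of a^{m/p^n} from the chosen fraction: both sides are powers of the component of
index n + n'. -/
theorem tilt_pow_eq_pow (a : tilt p S hS) {m n m' n' : ℕ} (h : m * p ^ n' = m' * p ^ n) :
    a.1 n ^ m = a.1 n' ^ m' := by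
  rw [← tilt_pow_pow a n n', ← tilt_pow_pow a n' n, ← pow_mul, ← pow_mul, add_comm n', mul_comm, h,
    mul_comm]

theorem tiltPow_frac (a : tilt p S hS) (m n : ℕ) : tiltPow a (frac p m n) = a.1 n ^ m := by
  apply tilt_pow_eq_pow
  have := (exists_eq_frac (frac p m n)).choose_spec.choose_spec
  exact (frac_eq_frac.1 this).symm

theorem tiltPow_nat (a : tilt p S hS) (m : ℕ) : tiltPow a (nat p m) = a.1 0 ^ m := tiltPow_frac a m 0

theorem tiltPow_zero (a : tilt p S hS) : tiltPow a 0 = 1 := by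
  rw [← frac_zero 0, tiltPow_frac, pow_zero]

theorem tiltPow_add (a : tilt p S hS) (q r : NonnegPAdicFrac p) :
    tiltPow a (q + r) = tiltPow a q * tiltPow a r := by
  obtain ⟨m, m', n, rfl, rfl⟩ := exists_eq_frac₂ q r
  rw [frac_add_frac, tiltPow_frac, tiltPow_frac, tiltPow_frac, pow_add]

theorem tiltPow_mul (a b : tilt p S hS) (q : NonnegPAdicFrac p) :
    tiltPow (a * b) q = tiltPow a q * tiltPow b q := by
  obtain ⟨m, n, rfl⟩ := exists_eq_frac q
  rw [tiltPow_frac, tiltPow_frac, tiltPow_frac]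
  exact mul_pow _ _ _

theorem tiltPow_of_zero {q : NonnegPAdicFrac p} (hq : q ≠ 0) : tiltPow (0 : tilt p S hS) q = 0 := by
  obtain ⟨m, n, rfl⟩ := exists_eq_frac q
  rw [tiltPow_frac]
  refine zero_pow fun h => hq ?_
  rw [h, frac_zero]

theorem map_tiltPow (f : S →+* T) (a : tilt p S hS) (q : NonnegPAdicFrac p) :
    f (tiltPow a q) = tiltPow (tiltMap p hS hT f a) q := by
  obtain ⟨m, n, rfl⟩ := exists_eq_frac q
  rw [tiltPow_frac, tiltPow_frac, map_pow]
  rfl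

/-- The power map `q ↦ a ^ q` as a monoid homomorphism. -/
noncomputable def tiltPowHom (a : tilt p S hS) : Multiplicative (NonnegPAdicFrac p) →* S where
  toFun q := tiltPow a q.toAdd
  map_one' := tiltPow_zero a
  map_mul' q r := tiltPow_add a q.toAdd r.toAdd

/-- The element `t^♭ = (t, t^{1/p}, …)` of `S[M]^♭` attached to a homomorphism
`h : ℤ[1/p]_{≥ 0} → M`, where `t^q` is the monomial with exponent `h q`. -/
noncomputable def monomialTilt (S : Type u) [CommRing S] {M : Type} [AddCommMonoid M]
    (h : NonnegPAdicFrac p →+ M) (hS : (p : AddMonoidAlgebra S M) = 0) :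
    tilt p (AddMonoidAlgebra S M) hS :=
  ⟨fun n => AddMonoidAlgebra.single (h (frac p 1 n)) 1, fun n => by
    rw [AddMonoidAlgebra.single_pow, one_pow, ← map_nsmul, nsmul_frac, mul_one]
    change _ = AddMonoidAlgebra.single (h (frac p 1 n)) 1
    rw [← frac_mul_pow 1 n 1, one_mul, pow_one]⟩

theorem tiltPow_monomialTilt {M : Type} [AddCommMonoid M]
    (h : NonnegPAdicFrac p →+ M) (hS : (p : AddMonoidAlgebra S M) = 0) (q : NonnegPAdicFrac p) :
    tiltPow (monomialTilt S h hS) q = AddMonoidAlgebra.single (h q) 1 := by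
  obtain ⟨m, n, rfl⟩ := exists_eq_frac q
  rw [tiltPow_frac]
  change AddMonoidAlgebra.single (h (frac p 1 n)) 1 ^ m = _
  rw [AddMonoidAlgebra.single_pow, one_pow, ← map_nsmul, nsmul_frac, mul_one]

end rpow

/-! ### The representing bialgebra and its convolution dual. -/

namespace PointedGaPerfModule

variable {p : ℕ} [hp : Fact p.Prime] {A : Type u} [CommRing A] [Algebra (ZMod p) A]

/-- A universal point of `X`, exhibiting `Spec B` as the affine scheme underlying `X`. -/
structure Representation (X : PointedGaPerfModule.{u} p A) (B : Type u) [CommRing B]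
    [Algebra A B] where
  point : X.pts B
  existsUnique (S : Type u) [CommRing S] [Algebra A S] (x : X.pts S) :
    ∃! f : B →ₐ[A] S, X.map f point = x

namespace Representation

variable {X : PointedGaPerfModule.{u} p A} {B : Type u} [CommRing B] [Algebra A B]
  (R : X.Representation B) {S T : Type u} [CommRing S] [Algebra A S] [CommRing T] [Algebra A T]

/-- The algebra homomorphism `B → S` corresponding to an `S`-point of `X`. -/
noncomputable def classify (x : X.pts S) : B →ₐ[A] S := (R.existsUnique S x).choose

theorem map_classify (x : X.pts S) : X.map (R.classify x) R.point = x :=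
  (R.existsUnique S x).choose_spec.1

theorem classify_eq {x : X.pts S} {f : B →ₐ[A] S} (h : X.map f R.point = x) : R.classify x = f :=
  (R.existsUnique S x).unique (R.map_classify x) h

theorem classify_injective : Function.Injective (R.classify : X.pts S → (B →ₐ[A] S)) :=
  fun x y h => by rw [← R.map_classify x, h, R.map_classify]

theorem classify_map (g : S →ₐ[A] T) (x : X.pts S) :
    R.classify (X.map g x) = g.comp (R.classify x) :=
  R.classify_eq (by rw [X.map_comp, R.map_classify])

theorem classify_map_apply (g : S →ₐ[A] T) (x : X.pts S) (b : B) :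
    R.classify (X.map g x) b = g (R.classify x b) := by
  rw [classify_map]; rfl

theorem map_comp_classify (g : S →ₐ[A] T) (x : X.pts S) :
    X.map (g.comp (R.classify x)) R.point = X.map g x := by
  rw [← R.classify_map, R.map_classify]

theorem classify_point : R.classify R.point = AlgHom.id A B := R.classify_eq (X.map_id _ _)

/-- The comultiplication on `B` given by the addition of `X`. -/
noncomputable def comul : B →ₐ[A] B ⊗[A] B :=
  R.classify (X.map Algebra.TensorProduct.includeLeft R.point +
    X.map Algebra.TensorProduct.includeRight R.point)

/-- The counit on `B` given by the zero section of `X`. -/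
noncomputable def counit : B →ₐ[A] A := R.classify 0

/-- By naturality it suffices to know the sum of the two universal points over B ⊗ B, which is what
the comultiplication classifies. -/
theorem classify_add (x y : X.pts S) : R.classify (x + y) =
    (Algebra.TensorProduct.lift (R.classify x) (R.classify y) fun _ _ => Commute.all _ _).comp
      R.comul := by
  apply R.classify_eq
  rw [X.map_comp, comul, R.map_classify, map_add, ← X.map_comp, ← X.map_comp,
    Algebra.TensorProduct.lift_comp_includeLeft, Algebra.TensorProduct.lift_comp_includeRight',
    R.map_classify, R.map_classify]

/-- The bialgebra structure on `B` given by the group structure of `X`. -/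
noncomputable abbrev bialgebra : Bialgebra A B :=
  Bialgebra.ofAlgHom R.comul R.counit
    (by
      have h1 : (Algebra.TensorProduct.map R.comul (.id A B)).comp R.comul =
          R.classify ((X.map (Algebra.TensorProduct.includeLeft.comp
            Algebra.TensorProduct.includeLeft) R.point + X.map (Algebra.TensorProduct.includeLeft.comp
            Algebra.TensorProduct.includeRight) R.point) +
            X.map Algebra.TensorProduct.includeRight R.point) := by
        symm
        apply R.classify_eq
        rw [X.map_comp, comul, R.map_classify, map_add, ← X.map_comp, ← X.map_comp,
          Algebra.TensorProduct.map_comp_includeLeft, Algebra.TensorProduct.map_comp_includeRight,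
          X.map_comp, R.map_classify, map_add, ← X.map_comp, ← X.map_comp]
        congr 1
      rw [h1, ← R.classify_map]
      apply R.classify_eq
      rw [X.map_comp, comul, R.map_classify, map_add, ← X.map_comp, ← X.map_comp, map_add, map_add,
        Algebra.TensorProduct.map_comp_includeLeft, Algebra.TensorProduct.map_comp_includeRight,
        R.map_comp_classify, map_add, ← X.map_comp, ← X.map_comp, ← X.map_comp, ← X.map_comp,
        ← X.map_comp, ← add_assoc]
      congr 1)
    (by
      rw [comul, ← R.classify_map]
      apply R.classify_eq
      rw [map_add, ← X.map_comp, ← X.map_comp, Algebra.TensorProduct.map_comp_includeLeft,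
        Algebra.TensorProduct.map_comp_includeRight, X.map_comp, counit, R.map_classify, map_zero,
        zero_add]
      congr 1)
    (by
      rw [comul, ← R.classify_map]
      apply R.classify_eq
      rw [map_add, ← X.map_comp, ← X.map_comp, Algebra.TensorProduct.map_comp_includeLeft,
        Algebra.TensorProduct.map_comp_includeRight, X.map_comp R.counit, counit, R.map_classify, map_zero,
        add_zero]
      congr 1)

/-- Commutativity of addition on X; it makes the convolution ring of functionals commutative. -/
theorem isCocomm : letI := R.bialgebra; Coalgebra.IsCocomm A B := by
  let := R.bialgebra
  refine ⟨?_⟩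
  have h : ((Algebra.TensorProduct.comm A B B).toAlgHom).comp R.comul = R.comul := by
    rw [comul, ← R.classify_map]
    apply R.classify_eq
    rw [R.map_classify, map_add, add_comm, ← X.map_comp, ← X.map_comp]
    congr 1
  exact congrArg AlgHom.toLinearMap h

/-- The linear functionals on `B`, a ring under convolution. -/
def Functional (_ : X.Representation B) : Type u := WithConv (B →ₗ[A] A)

noncomputable instance : CommRing R.Functional :=
  letI := R.bialgebra
  haveI := R.isCocomm
  inferInstanceAs (CommRing (WithConv (B →ₗ[A] A)))

noncomputable instance : Algebra A R.Functional :=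
  letI := R.bialgebra
  inferInstanceAs (Algebra A (WithConv (B →ₗ[A] A)))

/-- Evaluation of functionals. -/
noncomputable def eval : R.Functional →ₗ[A] (B →ₗ[A] A) where
  toFun φ := WithConv.ofConv φ
  map_add' _ _ := rfl
  map_smul' _ _ := rfl

/-- A linear form as an element of the convolution ring. -/
noncomputable def ofDual (φ : B →ₗ[A] A) : R.Functional := WithConv.toConv φ

theorem eval_injective : Function.Injective R.eval := WithConv.ofConv_injective

theorem eval_one (b : B) : R.eval 1 b = R.counit b := rfl

theorem eval_mul (φ ψ : R.Functional) (b : B) : R.eval (φ * ψ) b =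
    LinearMap.mul' A A (TensorProduct.map (R.eval φ) (R.eval ψ) (R.comul b)) := rfl

end Representation

end PointedGaPerfModule

/-! ### The grading given by the action, and the structure constants in a homogeneous basis. -/

namespace PointedGaPerfModule

namespace Representation

open NonnegPAdicFrac AddMonoidAlgebra

variable {p : ℕ} [hp : Fact p.Prime] {A : Type u} [CommRing A] [Algebra (ZMod p) A]
  {X : PointedGaPerfModule.{u} p A} {B : Type u} [CommRing B] [Algebra A B]
  (R : X.Representation B) {S T : Type u} [CommRing S] [Algebra A S] [CommRing T] [Algebra A T]

theorem classify_map_point (f : B →ₐ[A] S) : R.classify (X.map f R.point) = f :=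
  R.classify_eq rfl

/-- The algebra homomorphism `B → B[t^{1/p^∞}]` given by the action of `t^♭` on `X`. -/
noncomputable def coaction : B →ₐ[A] AddMonoidAlgebra B (NonnegPAdicFrac p) :=
  R.classify (monomialTilt B (AddMonoidHom.id _) (natCast_eq_zero_of_algebra p A _) •
    X.map (singleZeroAlgHom (R := A) (M := NonnegPAdicFrac p)) R.point)

/-- The algebra homomorphism `B[t^{1/p^∞}] → S` sending `t^♭` to `s` and extending `f`. -/
noncomputable def evalTilt (f : B →ₐ[A] S) (s : tilt p S (natCast_eq_zero_of_algebra p A S)) :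
    AddMonoidAlgebra B (NonnegPAdicFrac p) →ₐ[A] S :=
  liftNCAlgHom f (tiltPowHom s) fun _ _ => Commute.all _ _

theorem evalTilt_single (f : B →ₐ[A] S) (s : tilt p S (natCast_eq_zero_of_algebra p A S))
    (q : NonnegPAdicFrac p) (b : B) : evalTilt f s (single q b) = f b * tiltPow s q := by
  exact liftNC_single _ _ _ _

/-- The pair (t^♭, universal point) over B[t^{1/p^∞}] specialises to (s, x), so the coaction
determines scalar multiplication on all points. -/
theorem classify_smul (s : tilt p S (natCast_eq_zero_of_algebra p A S)) (x : X.pts S) :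
    R.classify (s • x) = (evalTilt (R.classify x) s).comp R.coaction := by
  apply R.classify_eq
  rw [coaction, R.map_comp_classify, X.map_smul, ← X.map_comp]
  congr 1
  · ext n
    change evalTilt _ s (single (frac p 1 n) 1) = _
    rw [evalTilt_single, map_one, one_mul, tiltPow_frac, pow_one]
  · have : (evalTilt (R.classify x) s).comp (singleZeroAlgHom (R := A) (M := NonnegPAdicFrac p)) =
        R.classify x := by
      ext b
      change evalTilt _ s (single 0 b) = _
      rw [evalTilt_single, tiltPow_zero, mul_one]
    rw [this, R.map_classify]

/-- The homogeneous elements of degree `q` in `B`. -/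
def IsHomogeneous (q : NonnegPAdicFrac p) (b : B) : Prop := R.coaction b = single q b

variable {R}

theorem IsHomogeneous.classify_smul {q : NonnegPAdicFrac p} {b : B} (h : R.IsHomogeneous q b)
    (s : tilt p S (natCast_eq_zero_of_algebra p A S)) (x : X.pts S) :
    R.classify (s • x) b = tiltPow s q * R.classify x b := by
  rw [R.classify_smul]
  change evalTilt _ s (R.coaction b) = _
  rw [h, evalTilt_single, mul_comm]

theorem IsHomogeneous.smul {q : NonnegPAdicFrac p} {b : B} (hb : R.IsHomogeneous q b)
    (a : A) : R.IsHomogeneous q (a • b) := by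
  rw [IsHomogeneous, _root_.map_smul, hb, smul_single]

variable (R)

/-- It is enough to use the hypothesis for the generic scalar t^♭ and the universal point. -/
theorem isHomogeneous_of_forall {q : NonnegPAdicFrac p} {b : B}
    (h : ∀ (S : Type u) [CommRing S] [Algebra A S]
      (s : tilt p S (natCast_eq_zero_of_algebra p A S)) (x : X.pts S),
      R.classify (s • x) b = tiltPow s q * R.classify x b) : R.IsHomogeneous q b := by
  rw [IsHomogeneous, coaction, h, tiltPow_monomialTilt, R.classify_map_point]
  change single q 1 * single 0 b = single q b
  rw [single_mul_single, add_zero, one_mul]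

theorem classify_tiltPow (x : X.pts S) (q : NonnegPAdicFrac p) :
    R.classify x (tiltPow (X.point B R.point) q) = tiltPow (X.point S x) q := by
  refine (map_tiltPow (hT := natCast_eq_zero_of_algebra p A S) (R.classify x).toRingHom _ _).trans ?_
  rw [← X.point_map, R.map_classify]

theorem isHomogeneous_tiltPow (q : NonnegPAdicFrac p) :
    R.IsHomogeneous q (tiltPow (X.point B R.point) q) := by
  apply R.isHomogeneous_of_forall
  intro S _ _ s x
  rw [R.classify_tiltPow, R.classify_tiltPow, _root_.map_smul, smul_eq_mul, tiltPow_mul]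

/-- The projection of `B` to its part of degree `q`. -/
noncomputable def proj (q : NonnegPAdicFrac p) : B →ₗ[A] B where
  toFun b := (R.coaction b).coeff q
  map_add' b c := by rw [map_add]; rfl
  map_smul' a b := by rw [_root_.map_smul]; rfl

theorem IsHomogeneous.proj_eq {R : X.Representation B} {q : NonnegPAdicFrac p} {b : B}
    (h : R.IsHomogeneous q b) : R.proj q b = b := by
  change (R.coaction b).coeff q = b
  rw [h]
  simp

/-- Associativity of the action. With two independent generic scalars s and t, acting by t and then
by s agrees with acting by st. The coefficient of s^q is the coaction of `proj q b` in the first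
case, and `proj q b` times t^q in the second. -/
theorem isHomogeneous_proj (q : NonnegPAdicFrac p) (b : B) : R.IsHomogeneous q (R.proj q b) := by
  let Q := NonnegPAdicFrac p
  let B₁ := AddMonoidAlgebra B Q
  let B₂ := AddMonoidAlgebra B₁ Q
  let ι₁ : B →ₐ[A] B₁ := singleZeroAlgHom (R := A) (M := Q)
  let ι₂ : B₁ →ₐ[A] B₂ := singleZeroAlgHom (R := A) (M := Q)
  let t := monomialTilt B (AddMonoidHom.id Q) (natCast_eq_zero_of_algebra p A B₁)
  let s := monomialTilt B₁ (AddMonoidHom.id Q) (natCast_eq_zero_of_algebra p A B₂)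
  let t' := tiltMap p (natCast_eq_zero_of_algebra p A B₁) (natCast_eq_zero_of_algebra p A B₂)
    ι₂.toRingHom t
  have h1 : ∀ y : B₁, (evalTilt (ι₂.comp R.coaction) s y).coeff q = R.coaction (y.coeff q) := by
    intro y
    induction y using AddMonoidAlgebra.induction_linear with
    | zero => simp
    | add f g hf hg =>
      rw [map_add]
      exact (congrArg₂ (· + ·) hf hg).trans (map_add R.coaction _ _).symm
    | single r c =>
      rw [evalTilt_single, tiltPow_monomialTilt]
      change (single 0 (R.coaction c) * single r 1).coeff q = _
      rw [single_mul_single, zero_add, mul_one, coeff_single, coeff_single]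
      classical
      rw [Finsupp.single_apply, Finsupp.single_apply]
      split_ifs
      · rfl
      · rw [map_zero]
  have h2 : ∀ y : B₁, (evalTilt (ι₂.comp ι₁) (s * t') y).coeff q = single q (y.coeff q) := by
    intro y
    induction y using AddMonoidAlgebra.induction_linear with
    | zero => simp
    | add f g hf hg =>
      rw [map_add]
      exact (congrArg₂ (· + ·) hf hg).trans (single_add _ _ _).symm
    | single r c =>
      rw [evalTilt_single, tiltPow_mul, tiltPow_monomialTilt, ← map_tiltPow, tiltPow_monomialTilt]
      change (single 0 (single 0 c) * (single r 1 * single 0 (single r 1))).coeff q = _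
      have e : (single (0 : Q) (single (0 : Q) c) : B₂) * (single r 1 * single 0 (single r 1)) =
          single r (single r c) := by
        rw [single_mul_single, single_mul_single, one_mul, zero_add, add_zero]
        congr 1
        exact (single_mul_single _ _ _ _).trans (by rw [zero_add, mul_one])
      rw [e, coeff_single, coeff_single]
      classical
      rw [Finsupp.single_apply, Finsupp.single_apply]
      split_ifs with h
      · rw [h]
      · simp
  have h3 : R.classify ((s * t') • X.map (ι₂.comp ι₁) R.point) =
      R.classify (s • X.map ι₂ (t • X.map ι₁ R.point)) := by
    rw [X.map_smul, mul_smul, X.map_comp]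
  rw [R.classify_smul, R.classify_smul, R.classify_map_point, R.classify_map] at h3
  have h4 := congrArg (fun f => (f b).coeff q) h3
  exact (h1 _).symm.trans (h4.symm.trans (h2 _))

variable (b : Module.Basis (NonnegPAdicFrac p) A B)

/-- The coordinate functionals of a basis. -/
noncomputable def coord (q : NonnegPAdicFrac p) : R.Functional := R.ofDual (b.coord q)

theorem eval_coord (q : NonnegPAdicFrac p) (c : B) : R.eval (R.coord b q) c = b.repr c q := rfl

theorem eval_coord_mul_coord (i j : NonnegPAdicFrac p) (c : B) :
    R.eval (R.coord b i * R.coord b j) c = (b.tensorProduct b).repr (R.comul c) (i, j) := by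
  rw [eval_mul]
  generalize R.comul c = z
  induction z using TensorProduct.induction_on with
  | zero => simp
  | add x y hx hy => simp only [map_add, hx, hy, Finsupp.add_apply]
  | tmul x y =>
    rw [TensorProduct.map_tmul, LinearMap.mul'_apply, eval_coord, eval_coord,
      Module.Basis.tensorProduct_repr_tmul_apply, smul_eq_mul, mul_comm]

theorem functional_ext {φ ψ : R.Functional} (h : ∀ q, R.eval φ (b q) = R.eval ψ (b q)) : φ = ψ :=
  R.eval_injective (b.ext h)

variable {b} (hb : ∀ q, R.IsHomogeneous q (b q))
include hb

/-- The projection to degree q fixes c and kills the basis elements of all other degrees. -/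
theorem repr_eq_zero_of_ne {q r : NonnegPAdicFrac p} (hqr : r ≠ q) {c : B} (hc : R.IsHomogeneous q c) :
    b.repr c r = 0 := by
  have h : ∀ c, b.repr (R.proj q c) r = 0 := by
    intro c
    have : (b.coord r).comp (R.proj q) = 0 := by
      refine b.ext fun k => ?_
      change b.repr ((R.coaction (b k)).coeff q) r = 0
      rw [hb k, coeff_single]
      classical
      rw [Finsupp.single_apply]
      split_ifs with hk
      · rw [b.repr_self, hk, Finsupp.single_eq_of_ne hqr]
      · simp
    exact LinearMap.congr_fun this c
  rw [← hc.proj_eq, h]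

theorem eq_smul_of_isHomogeneous {q : NonnegPAdicFrac p} {c : B} (hc : R.IsHomogeneous q c) :
    c = b.repr c q • b q := by
  apply b.ext_elem
  intro r
  rw [_root_.map_smul, b.repr_self, Finsupp.smul_apply]
  by_cases h : r = q
  · rw [h]; simp
  · rw [R.repr_eq_zero_of_ne hb h hc, Finsupp.single_eq_of_ne h, smul_zero]

/-- The comultiplication preserves degrees because s(x + y) = sx + sy for a generic scalar s. -/
theorem comul_repr_eq_zero {i j d : NonnegPAdicFrac p} (hd : i + j ≠ d) :
    (b.tensorProduct b).repr (R.comul (b d)) (i, j) = 0 := by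
  let Q := NonnegPAdicFrac p
  let S := AddMonoidAlgebra (B ⊗[A] B) Q
  let ι : B ⊗[A] B →ₐ[A] S := singleZeroAlgHom (R := A) (M := Q)
  let s := monomialTilt (B ⊗[A] B) (AddMonoidHom.id Q) (natCast_eq_zero_of_algebra p A S)
  let x := X.map (Algebra.TensorProduct.includeLeft : B →ₐ[A] B ⊗[A] B) R.point
  let y := X.map (Algebra.TensorProduct.includeRight : B →ₐ[A] B ⊗[A] B) R.point
  have h1 : R.classify (s • X.map ι (x + y)) (b d) = single d (R.comul (b d)) := by
    rw [(hb d).classify_smul, tiltPow_monomialTilt, R.classify_map]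
    change single d 1 * single 0 (R.comul (b d)) = _
    rw [single_mul_single, add_zero, one_mul]
  rw [map_add, smul_add, R.classify_add] at h1
  have hx (k : Q) : R.classify (s • X.map ι x) (b k) = single k (b k ⊗ₜ[A] (1 : B)) := by
    rw [(hb k).classify_smul, tiltPow_monomialTilt, R.classify_map, R.classify_map_point]
    change single k 1 * single 0 (b k ⊗ₜ[A] (1 : B)) = _
    rw [single_mul_single, add_zero, one_mul]
  have hy (k : Q) : R.classify (s • X.map ι y) (b k) = single k ((1 : B) ⊗ₜ[A] b k) := by
    rw [(hb k).classify_smul, tiltPow_monomialTilt, R.classify_map, R.classify_map_point]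
    change single k 1 * single 0 ((1 : B) ⊗ₜ[A] b k) = _
    rw [single_mul_single, add_zero, one_mul]
  -- Scaling both points by s multiplies b_k ⊗ b_l by s^{k+l}, so the coefficient of s^{i+j} retains
  -- the coordinate at (i, j).
  have h2 : ∀ z : B ⊗[A] B, (b.tensorProduct b).repr ((Algebra.TensorProduct.lift
      (R.classify (s • X.map ι x)) (R.classify (s • X.map ι y)) (fun _ _ => Commute.all _ _)
        z).coeff (i + j)) (i, j) = (b.tensorProduct b).repr z (i, j) := by
    intro z
    rw [← (b.tensorProduct b).linearCombination_repr z, Finsupp.linearCombination_apply]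
    induction (b.tensorProduct b).repr z using Finsupp.induction_linear with
    | zero => simp
    | add f g hf hg =>
      rw [Finsupp.sum_add_index' (by simp) (by simp [add_smul])]
      rw [map_add (F := B ⊗[A] B →ₐ[A] S), map_add (b.tensorProduct b).repr, Finsupp.add_apply,
        coeff_add, Finsupp.add_apply, map_add (b.tensorProduct b).repr, Finsupp.add_apply]
      exact congrArg₂ (· + ·) hf hg
    | single kl a =>
      obtain ⟨k, l⟩ := kl
      rw [Finsupp.sum_single_index (by simp), _root_.map_smul, coeff_smul, Finsupp.smul_apply, _root_.map_smul,
        _root_.map_smul, Module.Basis.tensorProduct_apply, Algebra.TensorProduct.lift_tmul,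
        hx, hy, single_mul_single, Algebra.TensorProduct.tmul_mul_tmul, one_mul, mul_one,
        coeff_single]
      classical
      rw [Finsupp.single_apply]
      split_ifs with h
      · rfl
      · rw [← Module.Basis.tensorProduct_apply, Module.Basis.repr_self, map_zero,
          Finsupp.smul_apply, Finsupp.smul_apply, Finsupp.single_eq_of_ne]
        · rfl
        · rintro ⟨⟩; exact h rfl
  rw [← h2]
  have h3 := congrArg (fun z : S => (b.tensorProduct b).repr (z.coeff (i + j)) (i, j)) h1
  refine h3.trans ?_
  simp only [coeff_single]
  rw [Finsupp.single_eq_of_ne hd, map_zero, Finsupp.zero_apply]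

/-- Dual form of the preceding degree count: the product of two coordinates is supported in the
single degree i + j. -/
theorem coord_mul_coord (i j : NonnegPAdicFrac p) : R.coord b i * R.coord b j =
    R.eval (R.coord b i * R.coord b j) (b (i + j)) • R.coord b (i + j) := by
  refine R.functional_ext b fun d => ?_
  rw [_root_.map_smul, LinearMap.smul_apply, eval_coord, b.repr_self]
  by_cases h : i + j = d
  · rw [h]; simp
  · rw [Finsupp.single_eq_of_ne h, smul_zero, eval_coord_mul_coord, R.comul_repr_eq_zero hb h]

/-- The product of basis elements of degrees `u / p ^ n` and `v / p ^ n` is determined by the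
comultiplication as soon as the binomial coefficient does not vanish. -/
theorem choose_smul_basis (u v n : ℕ) : ((u + v).choose u : A) • b (frac p (u + v) n) =
    R.eval (R.coord b (frac p u n) * R.coord b (frac p v n)) (b (frac p (u + v) n)) •
      (b (frac p u n) * b (frac p v n)) := by
  let Q := NonnegPAdicFrac p
  let S := AddMonoidAlgebra B (Q × Q)
  let ι : B →ₐ[A] S := singleZeroAlgHom (R := A) (M := Q × Q)
  let s := monomialTilt B (AddMonoidHom.inl Q Q) (natCast_eq_zero_of_algebra p A S)
  let t := monomialTilt B (AddMonoidHom.inr Q Q) (natCast_eq_zero_of_algebra p A S)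
  let x := X.map ι R.point
  -- The identity (s + t)x = sx + tx for two independent generic scalars, in bidegree (u/p^n,
  -- v/p^n).
  have h1 := congrArg (fun f => (f (b (frac p (u + v) n))).coeff (frac p u n, frac p v n))
    (congrArg R.classify (add_smul s t x))
  beta_reduce at h1
  rw [(hb _).classify_smul, R.classify_add, tiltPow_frac] at h1
  -- Evaluating at sx and tx puts b_k ⊗ b_l in bidegree (k, l), so one coordinate of z survives.
  have h2 : ∀ z : B ⊗[A] B, (Algebra.TensorProduct.lift (R.classify (s • x)) (R.classify (t • x))
      (fun _ _ => Commute.all _ _) z).coeff (frac p u n, frac p v n) =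
      (b.tensorProduct b).repr z (frac p u n, frac p v n) • (b (frac p u n) * b (frac p v n)) := by
    intro z
    rw [← (b.tensorProduct b).linearCombination_repr z, Finsupp.linearCombination_apply]
    induction (b.tensorProduct b).repr z using Finsupp.induction_linear with
    | zero => simp
    | add f g hf hg =>
      rw [Finsupp.sum_add_index' (by simp) (by simp [add_smul])]
      rw [map_add, map_add, coeff_add, Finsupp.add_apply, Finsupp.add_apply, add_smul]
      exact congrArg₂ (· + ·) hf hg
    | single kl a =>
      obtain ⟨k, l⟩ := kl
      rw [Finsupp.sum_single_index (by simp), _root_.map_smul, coeff_smul, Finsupp.smul_apply, _root_.map_smul,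
        Module.Basis.repr_self, Module.Basis.tensorProduct_apply, Algebra.TensorProduct.lift_tmul,
        (hb k).classify_smul, (hb l).classify_smul, tiltPow_monomialTilt, tiltPow_monomialTilt,
        R.classify_map_point]
      change a • (single (k, (0 : Q)) 1 * single (0 : Q × Q) (b k) * (single ((0 : Q), l) 1 *
        single (0 : Q × Q) (b l))).coeff _ = _
      rw [single_mul_single, single_mul_single, single_mul_single, one_mul, one_mul, add_zero,
        add_zero, coeff_single, Prod.mk_add_mk, add_zero, zero_add, Finsupp.smul_apply,
        smul_assoc]
      congr 1
      classical
      rw [Finsupp.single_apply, Finsupp.single_apply]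
      split_ifs with h
      · obtain ⟨rfl, rfl⟩ := Prod.mk.inj h
        rw [one_smul]
      · rw [zero_smul]
  rw [AlgHom.comp_apply, h2, ← eval_coord_mul_coord, R.classify_map_point] at h1
  rw [← h1]
  -- The power of s + t of exponent (u + v)/p^n is (s^{1/p^n} + t^{1/p^n})^(u+v), and only the
  -- binomial term of index u has the right bidegree.
  change _ = (((single ((frac p 1 n), (0 : Q)) 1 : S) + single ((0 : Q), frac p 1 n) 1) ^ (u + v) *
    single (0 : Q × Q) (b (frac p (u + v) n))).coeff _
  rw [add_pow, Finset.sum_mul, coeff_sum, Finsupp.finsetSum_apply, Finset.sum_eq_single u]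
  · rw [single_pow, single_pow, one_pow, one_pow, single_mul_single, Prod.smul_mk, Prod.smul_mk,
      smul_zero, smul_zero, nsmul_frac, nsmul_frac, Nat.add_sub_cancel_left, Prod.mk_add_mk,
      add_zero, zero_add, natCast_def, single_mul_single, single_mul_single, mul_one, mul_one,
      add_zero, add_zero, coeff_single, Finsupp.single_eq_same, one_mul, one_mul, Algebra.smul_def,
      map_natCast]
  · intro k hk hku
    rw [single_pow, single_pow, one_pow, one_pow, single_mul_single, Prod.smul_mk, Prod.smul_mk,
      smul_zero, smul_zero, nsmul_frac, nsmul_frac, Prod.mk_add_mk,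
      add_zero, zero_add, natCast_def, single_mul_single, single_mul_single, mul_one, mul_one,
      add_zero, add_zero, coeff_single, Finsupp.single_eq_of_ne]
    intro h
    have := frac_eq_frac.1 (Prod.mk.inj h).1
    exact hku (Nat.eq_of_mul_eq_mul_right (pow_pos hp.out.pos n) this).symm
  · intro h
    exact absurd (Finset.mem_range.2 (by omega)) h

end Representation

end PointedGaPerfModule

/-! ### Binomial coefficients modulo p. -/

/-- Lucas: each of the n lowest digits contributes a factor binom(·, 0) = 1, and what remains is
binom(m, m). -/
theorem choose_mul_pow_add_modEq_one {p : ℕ} [hp : Fact p.Prime] (m n c : ℕ) (hc : c < p ^ n) :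
    (m * p ^ n + c).choose (m * p ^ n) ≡ 1 [MOD p] := by
  induction n generalizing c with
  | zero =>
    obtain rfl : c = 0 := by simpa using hc
    simpa using Nat.ModEq.refl 1
  | succ n ih =>
    have hp0 := hp.out.pos
    refine (Choose.choose_modEq_choose_mod_mul_choose_div_nat).trans ?_
    have h1 : (m * p ^ (n + 1)) % p = 0 := by
      rw [pow_succ, ← mul_assoc, Nat.mul_mod_left]
    have h2 : (m * p ^ (n + 1)) / p = m * p ^ n := by
      rw [pow_succ, ← mul_assoc, Nat.mul_div_cancel _ hp0]
    have h3 : (m * p ^ (n + 1) + c) / p = m * p ^ n + c / p := by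
      rw [pow_succ, ← mul_assoc, add_comm, Nat.add_mul_div_right _ _ hp0, add_comm]
    rw [h1, h2, h3, Nat.choose_zero_right, one_mul]
    apply ih
    rw [Nat.div_lt_iff_lt_mul hp0, ← pow_succ]
    exact hc

/-- Lucas: removing k zero digits leaves binom(r, 1). -/
theorem choose_pow_mul_modEq {p : ℕ} [hp : Fact p.Prime] (k r : ℕ) :
    (p ^ k * r).choose (p ^ k) ≡ r [MOD p] := by
  induction k with
  | zero => simpa using Nat.ModEq.refl r
  | succ k ih =>
    have hp0 := hp.out.pos
    refine (Choose.choose_modEq_choose_mod_mul_choose_div_nat).trans ?_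
    rw [pow_succ', Nat.mul_mod_right, Nat.choose_zero_right, one_mul, Nat.mul_div_cancel_left _ hp0,
      mul_assoc, Nat.mul_div_cancel_left _ hp0]
    exact ih

theorem natCast_eq_of_modEq (p : ℕ) {A : Type*} [CommRing A] [Algebra (ZMod p) A] {m n : ℕ}
    (h : m ≡ n [MOD p]) : (m : A) = n := by
  rw [← map_natCast (algebraMap (ZMod p) A) m, (ZMod.natCast_eq_natCast_iff _ _ _).2 h, map_natCast]

theorem isUnit_natCast_of_not_dvd (p : ℕ) [Fact p.Prime] {A : Type*} [CommRing A]
    [Algebra (ZMod p) A] {r : ℕ} (h : ¬ p ∣ r) : IsUnit (r : A) := by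
  rw [← map_natCast (algebraMap (ZMod p) A) r]
  apply IsUnit.map
  rw [isUnit_iff_ne_zero, Ne, ZMod.natCast_eq_zero_iff]
  exact h

/-! ### Homomorphisms to u^*𝔾ₐ^♯ and their uniqueness. -/

namespace PointedGaPerfModule

open NonnegPAdicFrac

variable {p : ℕ} [hp : Fact p.Prime] {A : Type u} [CommRing A] [Algebra (ZMod p) A]

/-- A homomorphism from `X` to the pointed `𝔾ₐ^perf`-module `u^* 𝔾ₐ^♯` of divided power sequences
`x ↦ (dp x m)_m`. -/
structure DividedPowers (X : PointedGaPerfModule.{u} p A) where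
  dp {S : Type u} [CommRing S] [Algebra A S] : X.pts S → ℕ → S
  dp_map {S T : Type u} [CommRing S] [Algebra A S] [CommRing T] [Algebra A T] (f : S →ₐ[A] T)
    (x : X.pts S) (m : ℕ) : dp (X.map f x) m = f (dp x m)
  dp_zero {S : Type u} [CommRing S] [Algebra A S] (x : X.pts S) : dp x 0 = 1
  dp_one {S : Type u} [CommRing S] [Algebra A S] (x : X.pts S) : dp x 1 = (X.point S x).1 0
  dp_mul {S : Type u} [CommRing S] [Algebra A S] (x : X.pts S) (m l : ℕ) :
    dp x m * dp x l = (m + l).choose m * dp x (m + l)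
  dp_add {S : Type u} [CommRing S] [Algebra A S] (x y : X.pts S) (m : ℕ) :
    dp (x + y) m = ∑ ij ∈ Finset.HasAntidiagonal.antidiagonal m, dp x ij.1 * dp y ij.2
  dp_smul {S : Type u} [CommRing S] [Algebra A S]
    (a : tilt p S (natCast_eq_zero_of_algebra p A S)) (x : X.pts S) (m : ℕ) :
    dp (a • x) m = a.1 0 ^ m * dp x m

/-- The homomorphism to `u^* 𝔾ₐ^♯` given by `D` is bijective. -/
def DividedPowers.IsUniversal {X : PointedGaPerfModule.{u} p A} (D : X.DividedPowers) : Prop :=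
  ∀ (S : Type u) [CommRing S] [Algebra A S] (c : ℕ → S)
    (a : tilt p S (natCast_eq_zero_of_algebra p A S)), c 0 = 1 → c 1 = a.1 0 →
    (∀ m l, c m * c l = (m + l).choose m * c (m + l)) →
    ∃! x : X.pts S, D.dp x = c ∧ X.point S x = a

namespace Representation

variable {X : PointedGaPerfModule.{u} p A} {B : Type u} [CommRing B] [Algebra A B]
  (R : X.Representation B)

/-- A homogeneous basis of `B` with one element in every degree, given in degrees at most `1` by the
powers of the point. -/
structure HomogeneousBasis where
  basis : Module.Basis (NonnegPAdicFrac p) A B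
  homogeneous (q : NonnegPAdicFrac p) : R.IsHomogeneous q (basis q)
  eq_tiltPow (q : NonnegPAdicFrac p) (hq : (q : ℚ≥0) ≤ 1) :
    basis q = tiltPow (X.point B R.point) q

theorem comul_dp (D : X.DividedPowers) (m : ℕ) : R.comul (D.dp R.point m) =
    ∑ ij ∈ Finset.HasAntidiagonal.antidiagonal m, D.dp R.point ij.1 ⊗ₜ[A] D.dp R.point ij.2 := by
  rw [← D.dp_map, comul, R.map_classify, D.dp_add]
  refine Finset.sum_congr rfl fun ij _ => ?_
  rw [D.dp_map, D.dp_map]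
  simp

theorem isHomogeneous_dp (D : X.DividedPowers) (m : ℕ) :
    R.IsHomogeneous (nat p m) (D.dp R.point m) := by
  apply R.isHomogeneous_of_forall
  intro S _ _ s x
  rw [← D.dp_map, ← D.dp_map, R.map_classify, R.map_classify, D.dp_smul, tiltPow_nat]

variable {R} (H : R.HomogeneousBasis)

namespace HomogeneousBasis

theorem basis_zero : H.basis 0 = 1 := by
  rw [H.eq_tiltPow 0 (by simp), tiltPow_zero]

theorem basis_one : H.basis (nat p 1) = (X.point B R.point).1 0 := by
  rw [H.eq_tiltPow _ (by rw [coe_nat]; simp), tiltPow_nat, pow_one]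

/-- The unit for convolution is the counit. The zero section equals 0 • 0, so the counit multiplies
degree q by 0^q and vanishes in nonzero degrees. -/
theorem coord_zero : R.coord H.basis 0 = 1 := by
  refine R.functional_ext H.basis fun q => ?_
  rw [R.eval_coord, R.eval_one, Module.Basis.repr_self]
  by_cases h : q = 0
  · rw [h, H.basis_zero, map_one, Finsupp.single_eq_same]
  · have h0 : R.counit = R.classify ((0 : tilt p A (natCast_eq_zero_of_algebra p A A)) •
        (0 : X.pts A)) := by rw [smul_zero]; rfl
    rw [h0, (H.homogeneous q).classify_smul, tiltPow_of_zero h, zero_mul,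
      Finsupp.single_eq_of_ne (Ne.symm h)]

/-- By induction on m: in the comultiplication of the divided power of index m + 1, for degree
reasons only the term (m, 1) pairs nontrivially with c_1^m ⊗ c_1. -/
theorem eval_coord_one_pow_dp (D : X.DividedPowers) (m : ℕ) :
    R.eval (R.coord H.basis (nat p 1) ^ m) (D.dp R.point m) = 1 := by
  induction m with
  | zero => rw [pow_zero, R.eval_one, D.dp_zero, map_one]
  | succ m ih =>
    rw [pow_succ, R.eval_mul, R.comul_dp, map_sum, map_sum, Finset.sum_eq_single (m, 1)]
    · rw [TensorProduct.map_tmul, LinearMap.mul'_apply, ih, D.dp_one, one_mul, R.eval_coord,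
        ← H.basis_one, Module.Basis.repr_self, Finsupp.single_eq_same]
    · rintro ⟨k, l⟩ hkl hne
      rw [TensorProduct.map_tmul, LinearMap.mul'_apply, R.eval_coord,
        R.repr_eq_zero_of_ne H.homogeneous _ (R.isHomogeneous_dp D l), mul_zero]
      intro h
      have hl := nat_injective h
      rw [Finset.HasAntidiagonal.mem_antidiagonal] at hkl
      simp only at hl hkl
      exact hne (by ext <;> simp <;> omega)
    · intro h
      exact absurd (Finset.HasAntidiagonal.mem_antidiagonal.2 (show m + 1 = m + 1 from rfl)) h

include H in
/-- There is at most one homomorphism from `X` to `u^* 𝔾ₐ^♯`. -/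
theorem dp_unique (D D' : X.DividedPowers) {S : Type u} [CommRing S] [Algebra A S] (x : X.pts S)
    (m : ℕ) : D.dp x m = D'.dp x m := by
  rw [← R.map_classify x, D.dp_map, D'.dp_map]
  congr 1
  have h := R.eq_smul_of_isHomogeneous H.homogeneous (R.isHomogeneous_dp D m)
  have h' := R.eq_smul_of_isHomogeneous H.homogeneous (R.isHomogeneous_dp D' m)
  have e := H.eval_coord_one_pow_dp D m
  have e' := H.eval_coord_one_pow_dp D' m
  rw [h, _root_.map_smul, smul_eq_mul] at e
  rw [h', _root_.map_smul, smul_eq_mul] at e'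
  rw [h, h']
  congr 1
  -- Both divided powers are multiples of the basis element of degree m; each factor is inverse to
  -- the value of c_1^m on it.
  exact left_inv_eq_right_inv e ((mul_comm _ _).trans e')

end HomogeneousBasis

end Representation

end PointedGaPerfModule

/-! ### Rigidity: without primitive elements in degrees p^n, X is u^*𝔾ₐ^♯. -/

namespace PointedGaPerfModule

open NonnegPAdicFrac

namespace Representation

namespace HomogeneousBasis

variable {p : ℕ} [hp : Fact p.Prime] {A : Type u} [CommRing A] [Algebra (ZMod p) A]
  {X : PointedGaPerfModule.{u} p A} {B : Type u} [CommRing B] [Algebra A B]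
  {R : X.Representation B} (H : R.HomogeneousBasis)

/-- The structure constants of the comultiplication. -/
noncomputable def comulCoeff (i j : NonnegPAdicFrac p) : A :=
  R.eval (R.coord H.basis i * R.coord H.basis j) (H.basis (i + j))

theorem coord_mul_coord (i j : NonnegPAdicFrac p) : R.coord H.basis i * R.coord H.basis j =
    H.comulCoeff i j • R.coord H.basis (i + j) := R.coord_mul_coord H.homogeneous i j

theorem choose_smul_basis (u v n : ℕ) : ((u + v).choose u : A) • H.basis (frac p (u + v) n) =
    H.comulCoeff (frac p u n) (frac p v n) • (H.basis (frac p u n) * H.basis (frac p v n)) := by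
  rw [R.choose_smul_basis H.homogeneous, comulCoeff, frac_add_frac]

/-- In `choose_smul_basis`, the coordinate at (u + v)/p^n exhibits the structure constant as a
divisor of the binomial coefficient. -/
theorem isUnit_comulCoeff {u v : ℕ} (n : ℕ) (h : IsUnit ((u + v).choose u : A)) :
    IsUnit (H.comulCoeff (frac p u n) (frac p v n)) := by
  have h1 := congrArg (H.basis.coord (frac p (u + v) n)) (H.choose_smul_basis u v n)
  rw [_root_.map_smul, _root_.map_smul, Module.Basis.coord_apply, Module.Basis.repr_self,
    Finsupp.single_eq_same, smul_eq_mul, mul_one, smul_eq_mul] at h1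
  rw [h1] at h
  exact isUnit_of_mul_isUnit_left h

theorem isUnit_comulCoeff_nat_of_lt_one (m : ℕ) {r : NonnegPAdicFrac p} (hr : (r : ℚ≥0) < 1) :
    IsUnit (H.comulCoeff (nat p m) r) ∧
      H.basis (nat p m + r) = H.comulCoeff (nat p m) r • (H.basis (nat p m) * H.basis r) := by
  obtain ⟨c, n, hc, rfl⟩ := exists_frac_of_lt_one hr
  have h : (((m * p ^ n + c).choose (m * p ^ n) : ℕ) : A) = 1 := by
    rw [natCast_eq_of_modEq p (choose_mul_pow_add_modEq_one m n c hc), Nat.cast_one]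
  rw [nat_eq_frac m n]
  refine ⟨H.isUnit_comulCoeff n (by rw [h]; exact isUnit_one), ?_⟩
  rw [frac_add_frac, ← H.choose_smul_basis, h, one_smul]

/-- The basis element of degree 1 is the zeroth component of the point, hence additive, so its
comultiplication has no mixed terms. -/
theorem coord_mul_coord_eq_zero {i j : NonnegPAdicFrac p} (hi : i ≠ 0) (hj : j ≠ 0)
    (h : i + j = nat p 1) : R.coord H.basis i * R.coord H.basis j = 0 := by
  rw [H.coord_mul_coord, comulCoeff, h, R.eval_coord_mul_coord]
  have h1 : R.comul (H.basis (nat p 1)) =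
      H.basis (nat p 1) ⊗ₜ H.basis 0 + H.basis 0 ⊗ₜ H.basis (nat p 1) := by
    rw [H.basis_zero, H.eq_tiltPow _ (by rw [coe_nat]; simp), comul, R.classify_tiltPow, map_add,
      X.point_map, X.point_map, tiltPow_nat, tiltPow_nat, pow_one, pow_one]
    rfl
  rw [h1, map_add, Finsupp.add_apply, Module.Basis.tensorProduct_repr_tmul_apply,
    Module.Basis.tensorProduct_repr_tmul_apply, Module.Basis.repr_self, Module.Basis.repr_self,
    Finsupp.single_eq_of_ne hi, Finsupp.single_eq_of_ne hj, smul_zero, zero_smul, add_zero,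
    zero_smul]

theorem coord_nat_mul_fract (q : NonnegPAdicFrac p) : ∃ u : Aˣ, R.coord H.basis q =
    (u : A) • (R.coord H.basis (nat p (floor q)) * R.coord H.basis (fract q)) := by
  obtain ⟨u, hu⟩ := (H.isUnit_comulCoeff_nat_of_lt_one (floor q) (fract_lt_one q)).1
  refine ⟨u⁻¹, ?_⟩
  rw [H.coord_mul_coord, ← hu, nat_floor_add_fract, smul_smul, Units.inv_mul, one_smul]

/-- A product of coordinates whose degrees are not integral, but add up to an integer, vanishes. -/
theorem coord_mul_coord_eq_zero_of_fract {i j : NonnegPAdicFrac p} (hi : fract i ≠ 0)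
    (h : fract i + fract j = nat p 1) : R.coord H.basis i * R.coord H.basis j = 0 := by
  have hj : fract j ≠ 0 := by
    intro hj
    rw [hj, add_zero] at h
    have := fract_lt_one i
    rw [h, coe_nat] at this
    simp at this
  obtain ⟨u, hu⟩ := H.coord_nat_mul_fract i
  obtain ⟨v, hv⟩ := H.coord_nat_mul_fract j
  -- Up to units each coordinate splits into an integral and a fractional factor; the two fractional
  -- factors have total degree 1 and multiply to 0.
  rw [hu, hv, smul_mul_smul_comm, mul_mul_mul_comm, H.coord_mul_coord_eq_zero hi hj h, mul_zero,
    smul_zero]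

/-- The condition that `B` has no primitive elements in the degrees `p ^ n`, `n ≥ 1`. -/
def NoPrimitives : Prop := ∀ n, 1 ≤ n → ∃ i j : NonnegPAdicFrac p, i ≠ 0 ∧ j ≠ 0 ∧
  i + j = nat p (p ^ n) ∧ IsUnit (H.comulCoeff i j)

variable {H}

/-- Strong induction: it suffices to write m as a sum of two smaller integers whose structure
constant is a unit. For m = p^k r with r > 1 prime to p, Lucas provides one. For m = p^k with k ≥ 1
the hypothesis on primitives does, since its degrees i and j must be integral. -/
theorem NoPrimitives.exists_coord_one_pow (hH : H.NoPrimitives) (m : ℕ) :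
    ∃ u : Aˣ, R.coord H.basis (nat p 1) ^ m = (u : A) • R.coord H.basis (nat p m) := by
  induction m using Nat.strong_induction_on with
  | _ m ih =>
  have step (i j : ℕ) (hi : i < m) (hj : j < m) (hij : i + j = m)
      (h : IsUnit (H.comulCoeff (nat p i) (nat p j))) :
      ∃ u : Aˣ, R.coord H.basis (nat p 1) ^ m = (u : A) • R.coord H.basis (nat p m) := by
    obtain ⟨u, hu⟩ := ih i hi
    obtain ⟨v, hv⟩ := ih j hj
    obtain ⟨w, hw⟩ := h
    refine ⟨u * v * w, ?_⟩
    rw [← hij, pow_add, hu, hv, smul_mul_smul_comm, H.coord_mul_coord, ← hw, smul_smul, nat_add]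
    rfl
  rcases Nat.eq_zero_or_pos m with rfl | hm
  · exact ⟨1, by rw [pow_zero, nat_zero, H.coord_zero, Units.val_one, one_smul]⟩
  obtain ⟨k, r, hr, rfl⟩ := Nat.exists_eq_pow_mul_and_not_dvd hm.ne' p hp.out.ne_one
  rcases Nat.lt_or_ge 1 r with h1 | h1
  · have hpk : 0 < p ^ k := pow_pos hp.out.pos k
    have hr1 : p ^ k + p ^ k * (r - 1) = p ^ k * r := by
      rw [Nat.mul_sub_one]
      exact Nat.add_sub_cancel' (Nat.le_mul_of_pos_right _ (by omega))
    have hr2 : 0 < p ^ k * (r - 1) := Nat.mul_pos hpk (by omega)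
    -- The binomial coefficient of this splitting is congruent to r modulo p.
    refine step (p ^ k) (p ^ k * (r - 1)) (by omega) (by omega) hr1 ?_
    apply H.isUnit_comulCoeff
    rw [hr1, natCast_eq_of_modEq p (choose_pow_mul_modEq k r)]
    exact isUnit_natCast_of_not_dvd p hr
  · have hr' : r = 1 := by
      rcases Nat.eq_zero_or_pos r with rfl | h
      · exact absurd (dvd_zero p) hr
      · omega
    subst hr'
    rw [mul_one] at *
    rcases Nat.eq_zero_or_pos k with rfl | hk
    · exact ⟨1, by rw [pow_zero, pow_one, Units.val_one, one_smul]⟩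
    obtain ⟨i, j, hi, hj, hij, hu⟩ := hH k hk
    rcases fract_add_fract hij with ⟨h1, h2, h3⟩ | ⟨h1, h2, -⟩
    · have hi' := nat_floor_add_fract i
      have hj' := nat_floor_add_fract j
      rw [h1, add_zero] at hi'
      rw [h2, add_zero] at hj'
      have hi0 : floor i ≠ 0 := fun h => hi (by rw [← hi', h, nat_zero])
      have hj0 : floor j ≠ 0 := fun h => hj (by rw [← hj', h, nat_zero])
      refine step (floor i) (floor j) (by omega) (by omega) h3 ?_
      rw [hi', hj']
      exact hu
    -- Non-integral degrees have structure constant 0, which is a unit only over the zero ring.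
    · have h0 : H.comulCoeff i j = 0 := by
        rw [comulCoeff, H.coord_mul_coord_eq_zero_of_fract h1 h2, map_zero, LinearMap.zero_apply]
      rw [h0, isUnit_zero_iff] at hu
      have : Subsingleton A := subsingleton_of_zero_eq_one hu
      have := Module.subsingleton A R.Functional
      exact ⟨1, Subsingleton.elim _ _⟩

/-- The divided powers of the zeroth component of the point. -/
noncomputable def NoPrimitives.gamma (hH : H.NoPrimitives) (m : ℕ) : B :=
  (((hH.exists_coord_one_pow m).choose⁻¹ : Aˣ) : A) • H.basis (nat p m)

theorem NoPrimitives.exists_gamma_eq (hH : H.NoPrimitives) (m : ℕ) : ∃ u : Aˣ,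
    R.coord H.basis (nat p 1) ^ m = (u : A) • R.coord H.basis (nat p m) ∧
      hH.gamma m = ((u⁻¹ : Aˣ) : A) • H.basis (nat p m) :=
  ⟨_, (hH.exists_coord_one_pow m).choose_spec, rfl⟩

theorem NoPrimitives.eval_coord_one_pow_gamma (hH : H.NoPrimitives) (m : ℕ) :
    R.eval (R.coord H.basis (nat p 1) ^ m) (hH.gamma m) = 1 := by
  obtain ⟨u, h1, h2⟩ := hH.exists_gamma_eq m
  rw [h1, h2, _root_.map_smul, _root_.map_smul, LinearMap.smul_apply, R.eval_coord,
    Module.Basis.repr_self, Finsupp.single_eq_same, smul_smul, Units.inv_mul, one_smul]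

theorem NoPrimitives.isHomogeneous_gamma (hH : H.NoPrimitives) (m : ℕ) :
    R.IsHomogeneous (nat p m) (hH.gamma m) := (H.homogeneous _).smul _

theorem NoPrimitives.gamma_zero (hH : H.NoPrimitives) : hH.gamma 0 = 1 := by
  have h := hH.eval_coord_one_pow_gamma 0
  obtain ⟨u, h1, h2⟩ := hH.exists_gamma_eq 0
  rw [h2, _root_.map_smul, nat_zero, H.basis_zero, pow_zero, R.eval_one, map_one, smul_eq_mul,
    mul_one] at h
  rw [h2, h, one_smul, nat_zero, H.basis_zero]

theorem NoPrimitives.gamma_one (hH : H.NoPrimitives) :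
    hH.gamma 1 = (X.point B R.point).1 0 := by
  have h := hH.eval_coord_one_pow_gamma 1
  obtain ⟨u, h1, h2⟩ := hH.exists_gamma_eq 1
  rw [h2, _root_.map_smul, pow_one, R.eval_coord, Module.Basis.repr_self, Finsupp.single_eq_same,
    smul_eq_mul, mul_one] at h
  rw [h2, h, one_smul, H.basis_one]

/-- Evaluating c_1^{m+l} = c_1^m c_1^l on the basis element of degree m + l expresses the structure
constant through the normalising units. With it, `choose_smul_basis` becomes the divided power
relation. -/
theorem NoPrimitives.gamma_mul (hH : H.NoPrimitives) (m l : ℕ) :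
    hH.gamma m * hH.gamma l = (m + l).choose m * hH.gamma (m + l) := by
  obtain ⟨u, h1, h2⟩ := hH.exists_gamma_eq m
  obtain ⟨v, h3, h4⟩ := hH.exists_gamma_eq l
  obtain ⟨w, h5, h6⟩ := hH.exists_gamma_eq (m + l)
  have h7 : (u * v : A) * H.comulCoeff (nat p m) (nat p l) = w := by
    have := congrArg (fun φ => R.eval φ (H.basis (nat p (m + l)))) h5
    beta_reduce at this
    rw [pow_add, h1, h3, smul_mul_smul_comm, H.coord_mul_coord, smul_smul, ← nat_add,
      _root_.map_smul, _root_.map_smul, LinearMap.smul_apply, LinearMap.smul_apply, R.eval_coord,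
      Module.Basis.repr_self, Finsupp.single_eq_same, smul_eq_mul, smul_eq_mul, mul_one, mul_one]
      at this
    exact this
  have h8 : H.comulCoeff (nat p m) (nat p l) = ((u⁻¹ * v⁻¹ * w : Aˣ) : A) := by
    rw [Units.val_mul, ← h7, ← mul_assoc, ← Units.val_mul, ← Units.val_mul, ← mul_inv,
      inv_mul_cancel, Units.val_one, one_mul]
  have h9 := H.choose_smul_basis m l 0
  have h10 : ((m + l).choose m * H.basis (nat p (m + l)) : B) =
      ((m + l).choose m : A) • H.basis (nat p (m + l)) := by
    rw [Algebra.smul_def, map_natCast]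
  rw [h2, h4, h6, smul_mul_smul_comm, mul_smul_comm, h10]
  change _ = _ • ((m + l).choose m : A) • H.basis (frac p (m + l) 0)
  rw [h9]
  change _ = _ • H.comulCoeff (nat p m) (nat p l) • (H.basis (nat p m) * H.basis (nat p l))
  rw [h8, smul_smul, ← Units.val_mul, ← Units.val_mul]
  congr 2
  rw [mul_comm w⁻¹, mul_assoc, mul_inv_cancel, mul_one]

/-- The formula is dual to c_1^i c_1^j = c_1^{i+j}. Mixed terms of non-integral degree vanish by
`coord_mul_coord_eq_zero_of_fract`. -/
theorem NoPrimitives.comul_gamma (hH : H.NoPrimitives) (m : ℕ) : R.comul (hH.gamma m) =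
    ∑ ij ∈ Finset.HasAntidiagonal.antidiagonal m, hH.gamma ij.1 ⊗ₜ[A] hH.gamma ij.2 := by
  apply (H.basis.tensorProduct H.basis).ext_elem
  rintro ⟨i, j⟩
  have hrepr (k : ℕ) (q : NonnegPAdicFrac p) (hq : nat p k ≠ q) :
      H.basis.repr (hH.gamma k) q = 0 :=
    R.repr_eq_zero_of_ne H.homogeneous hq.symm (hH.isHomogeneous_gamma k)
  rw [map_sum, Finsupp.finsetSum_apply]
  simp_rw [Module.Basis.tensorProduct_repr_tmul_apply]
  by_cases hij : i + j = nat p m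
  · rcases fract_add_fract hij with ⟨h1, h2, h3⟩ | ⟨h1, h2, -⟩
    · have hi' := nat_floor_add_fract i
      have hj' := nat_floor_add_fract j
      rw [h1, add_zero] at hi'
      rw [h2, add_zero] at hj'
      obtain ⟨u, h4, h5⟩ := hH.exists_gamma_eq (floor i)
      obtain ⟨v, h6, h7⟩ := hH.exists_gamma_eq (floor j)
      rw [Finset.sum_eq_single (floor i, floor j)]
      · rw [← R.eval_coord_mul_coord, ← R.eval_coord, ← R.eval_coord]
        have h8 := hH.eval_coord_one_pow_gamma m
        rw [← h3, pow_add, h4, h6, smul_mul_smul_comm, _root_.map_smul, LinearMap.smul_apply, h3,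
          hi', hj', ← Units.val_mul] at h8
        have h9 : R.eval (R.coord H.basis i * R.coord H.basis j) (hH.gamma m) =
            (((u * v)⁻¹ : Aˣ) : A) := by
          rw [← mul_one (((u * v)⁻¹ : Aˣ) : A), ← h8, smul_eq_mul, ← mul_assoc, Units.inv_mul,
            one_mul]
        rw [h9, h5, h7, hi', hj', _root_.map_smul, _root_.map_smul, R.eval_coord, R.eval_coord,
          Module.Basis.repr_self, Module.Basis.repr_self, Finsupp.single_eq_same,
          Finsupp.single_eq_same, smul_eq_mul, smul_eq_mul, smul_eq_mul, mul_one, mul_one, mul_inv,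
          Units.val_mul, mul_comm]
      · rintro ⟨k, l⟩ - hne
        by_cases hk : nat p k = i
        · rw [hrepr l j, zero_smul]
          intro hl
          refine hne (Prod.ext ?_ ?_)
          · rw [← hk, floor_nat]
          · rw [← hl, floor_nat]
        · rw [hrepr k i hk, smul_zero]
      · intro h
        exact absurd (Finset.HasAntidiagonal.mem_antidiagonal.2 h3) h
    · rw [← R.eval_coord_mul_coord, H.coord_mul_coord_eq_zero_of_fract h1 h2, map_zero,
        LinearMap.zero_apply, Finset.sum_eq_zero]
      rintro ⟨k, l⟩ -
      rw [hrepr k i, smul_zero]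
      intro h
      rw [← h, fract_nat] at h1
      exact h1 rfl
  · obtain ⟨u, -, h5⟩ := hH.exists_gamma_eq m
    rw [h5, _root_.map_smul, _root_.map_smul, Finsupp.smul_apply,
      R.comul_repr_eq_zero H.homogeneous hij, smul_zero, Finset.sum_eq_zero]
    rintro ⟨k, l⟩ hkl
    by_cases hk : nat p k = i
    · rw [hrepr l j, zero_smul]
      intro hl
      rw [← hk, ← hl, ← nat_add, Finset.HasAntidiagonal.mem_antidiagonal.1 hkl] at hij
      exact hij rfl
    · rw [hrepr k i hk, smul_zero]

/-- The homomorphism from `X` to `u^* 𝔾ₐ^♯`. -/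
noncomputable def NoPrimitives.dividedPowers (hH : H.NoPrimitives) : X.DividedPowers where
  dp x m := R.classify x (hH.gamma m)
  dp_map f x m := R.classify_map_apply f x _
  dp_zero x := by rw [hH.gamma_zero, map_one]
  dp_one x := by
    rw [hH.gamma_one]
    have := R.classify_tiltPow x (nat p 1)
    rwa [tiltPow_nat, tiltPow_nat, pow_one, pow_one] at this
  dp_mul x m l := by rw [← map_mul, hH.gamma_mul, map_mul, map_natCast]
  dp_add x y m := by
    rw [R.classify_add, AlgHom.comp_apply, hH.comul_gamma, map_sum]
    simp only [Algebra.TensorProduct.lift_tmul]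
  dp_smul a x m := by rw [(hH.isHomogeneous_gamma m).classify_smul, tiltPow_nat]

/-- The basis of `B` consisting of the products of divided powers and fractional powers. -/
theorem NoPrimitives.exists_basis (hH : H.NoPrimitives) :
    ∃ b : Module.Basis (NonnegPAdicFrac p) A B,
      ∀ q, b q = hH.gamma (floor q) * tiltPow (X.point B R.point) (fract q) := by
  have h : ∀ q : NonnegPAdicFrac p, ∃ u : Aˣ,
      u • H.basis q = hH.gamma (floor q) * tiltPow (X.point B R.point) (fract q) := by
    intro q
    obtain ⟨u, -, hu⟩ := hH.exists_gamma_eq (floor q)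
    obtain ⟨⟨v, hv⟩, h1⟩ := H.isUnit_comulCoeff_nat_of_lt_one (floor q) (fract_lt_one q)
    refine ⟨u⁻¹ * v⁻¹, ?_⟩
    rw [hu, ← H.eq_tiltPow _ (fract_lt_one q).le]
    nth_rewrite 1 [← nat_floor_add_fract q]
    rw [h1, ← hv, mul_smul, ← Units.smul_def, inv_smul_smul, smul_mul_assoc, Units.smul_def]
  choose w hw using h
  exact ⟨H.basis.unitsSMul w, fun q => by rw [Module.Basis.unitsSMul_apply, hw]⟩

/-- The basis γ_{floor q} a^{fract q} forces the classifying map B → S of a given pair (c, a). What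
has to be checked is that the resulting linear map is multiplicative. -/
theorem NoPrimitives.isUniversal_dividedPowers (hH : H.NoPrimitives) :
    hH.dividedPowers.IsUniversal := by
  intro S _ _ c a hc0 hc1 hc
  obtain ⟨b, hb⟩ := hH.exists_basis
  let g : B →ₗ[A] S := b.constr A fun q => c (floor q) * tiltPow a (fract q)
  have hg (q : NonnegPAdicFrac p) : g (b q) = c (floor q) * tiltPow a (fract q) :=
    b.constr_basis _ _ _
  -- The definition of g covers exponents of a below 1. A larger exponent is lowered by absorbing
  -- a_0 = γ_1 into γ_m, at the cost of a factor m + 1 on both sides; hence m must vary in the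
  -- induction.
  have key (n : ℕ) : ∀ (m : ℕ) (r : NonnegPAdicFrac p), (r : ℚ≥0) < 1 →
      g (hH.gamma m * tiltPow (X.point B R.point) (nat p n + r)) =
        c m * tiltPow a (nat p n + r) := by
    induction n with
    | zero =>
      intro m r hr
      have := hg (nat p m + r)
      rw [hb, floor_nat_add hr, fract_nat_add hr] at this
      rw [nat_zero, zero_add, this]
    | succ n ih =>
      intro m r hr
      have e {T : Type u} [CommRing T] {hT : (p : T) = 0} (t : tilt p T hT) :
          tiltPow t (nat p (n + 1) + r) = t.1 0 * tiltPow t (nat p n + r) := by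
        rw [nat_add, add_comm (nat p n), add_assoc, tiltPow_add, tiltPow_nat, pow_one]
      have e2 : ((m + 1).choose m * hH.gamma (m + 1) *
          tiltPow (X.point B R.point) (nat p n + r) : B) = ((m + 1).choose m : A) •
            (hH.gamma (m + 1) * tiltPow (X.point B R.point) (nat p n + r)) := by
        rw [Algebra.smul_def, map_natCast, mul_assoc]
      rw [e, e, ← hH.gamma_one, ← hc1, ← mul_assoc, ← mul_assoc, hH.gamma_mul, e2, _root_.map_smul,
        ih _ _ hr, hc, Algebra.smul_def, map_natCast, mul_assoc]
  have key' (m : ℕ) (q : NonnegPAdicFrac p) :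
      g (hH.gamma m * tiltPow (X.point B R.point) q) = c m * tiltPow a q := by
    rw [← nat_floor_add_fract q]
    exact key _ _ _ (fract_lt_one q)
  let f : B →ₐ[A] S := AlgHom.ofLinearMap g
    (by
      have := key' 0 0
      rwa [hH.gamma_zero, tiltPow_zero, tiltPow_zero, hc0, mul_one, mul_one] at this)
    (by
      have : (LinearMap.mul A B).compr₂ g = (LinearMap.mul A S).compl₁₂ g g := by
        refine b.ext fun q => b.ext fun r => ?_
        change g (b q * b r) = g (b q) * g (b r)
        have e3 : b q * b r = (((floor q + floor r).choose (floor q) : ℕ) : A) •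
            (hH.gamma (floor q + floor r) *
              tiltPow (X.point B R.point) (fract q + fract r)) := by
          rw [hb, hb, mul_mul_mul_comm, ← tiltPow_add, hH.gamma_mul, Algebra.smul_def, map_natCast,
            mul_assoc]
        rw [e3, _root_.map_smul, key', hg, hg, tiltPow_add, mul_mul_mul_comm, hc, Algebra.smul_def,
          map_natCast, mul_assoc]
      exact fun x y => LinearMap.congr_fun (LinearMap.congr_fun this x) y)
  refine ⟨X.map f R.point, ⟨?_, ?_⟩, ?_⟩
  · funext m
    change R.classify (X.map f R.point) (hH.gamma m) = c m
    rw [R.classify_map_point]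
    have := key' m 0
    rwa [tiltPow_zero, tiltPow_zero, mul_one, mul_one] at this
  · rw [X.point_map]
    ext n
    have := key' 0 (frac p 1 n)
    rwa [hH.gamma_zero, hc0, one_mul, one_mul, tiltPow_frac, tiltPow_frac, pow_one, pow_one] at this
  · rintro x ⟨h1, h2⟩
    apply R.classify_injective
    rw [R.classify_map_point]
    apply AlgHom.toLinearMap_injective
    refine b.ext fun q => ?_
    change R.classify x (b q) = g (b q)
    rw [hg, hb, map_mul, R.classify_tiltPow, h2, ← h1]
    rfl

end HomogeneousBasis

end Representation

end PointedGaPerfModule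

/-! ### Comparing pointed modules through u^*𝔾ₐ^♯. -/

namespace PointedGaPerfModule

variable {p : ℕ} [hp : Fact p.Prime]

section

variable {A : Type u} [CommRing A] [Algebra (ZMod p) A]
  {X Y : PointedGaPerfModule.{u} p A}

/-- The inverse of an isomorphism. -/
def Iso.symm (e : Iso X Y) : Iso Y X where
  app S _ _ := (e.app S).symm
  naturality {S T} _ _ _ _ f y := by
    rw [LinearEquiv.symm_apply_eq, e.naturality, LinearEquiv.apply_symm_apply]
  point_app S _ _ y := by rw [← e.point_app, LinearEquiv.apply_symm_apply]

namespace DividedPowers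

/-- Transport of a homomorphism to `u^* 𝔾ₐ^♯` along an isomorphism. -/
def comap (E : Y.DividedPowers) (e : Iso X Y) : X.DividedPowers where
  dp {S} _ _ x m := E.dp (e.app S x) m
  dp_map f x m := by rw [e.naturality, E.dp_map]
  dp_zero x := E.dp_zero _
  dp_one {S} _ _ x := by rw [E.dp_one, e.point_app]
  dp_mul x m l := E.dp_mul _ _ _
  dp_add {S} _ _ x y m := by rw [map_add, E.dp_add]
  dp_smul {S} _ _ a x m := by rw [_root_.map_smul, E.dp_smul]

theorem IsUniversal.ext {E : Y.DividedPowers} (hE : E.IsUniversal) {S : Type u} [CommRing S]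
    [Algebra A S] {x y : Y.pts S} (h : ∀ m, E.dp x m = E.dp y m) (h' : Y.point S x = Y.point S y) :
    x = y :=
  (hE S (E.dp y) (Y.point S y) (E.dp_zero y) (E.dp_one y) (E.dp_mul y)).unique
    ⟨funext h, h'⟩ ⟨rfl, rfl⟩

variable (D : X.DividedPowers) {E : Y.DividedPowers} (hE : E.IsUniversal)

/-- The map `X → Y` compatible with the homomorphisms to `u^* 𝔾ₐ^♯`. -/
noncomputable def lift {S : Type u} [CommRing S] [Algebra A S] (x : X.pts S) : Y.pts S :=
  (hE S (D.dp x) (X.point S x) (D.dp_zero x) (D.dp_one x) (D.dp_mul x)).choose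

theorem dp_lift {S : Type u} [CommRing S] [Algebra A S] (x : X.pts S) :
    E.dp (D.lift hE x) = D.dp x :=
  (hE S (D.dp x) (X.point S x) (D.dp_zero x) (D.dp_one x) (D.dp_mul x)).choose_spec.1.1

theorem point_lift {S : Type u} [CommRing S] [Algebra A S] (x : X.pts S) :
    Y.point S (D.lift hE x) = X.point S x :=
  (hE S (D.dp x) (X.point S x) (D.dp_zero x) (D.dp_one x) (D.dp_mul x)).choose_spec.1.2

variable {D}

/-- Two pointed modules isomorphic to `u^* 𝔾ₐ^♯` are isomorphic. -/
noncomputable def iso (hD : D.IsUniversal) : Iso X Y where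
  app S _ _ :=
    { toFun := fun x => D.lift hE x
      invFun := fun y => E.lift hD y
      map_add' := fun x y => hE.ext (fun m => by
        rw [dp_lift, D.dp_add, E.dp_add]; simp_rw [dp_lift]) (by
        rw [map_add, point_lift, point_lift, point_lift, map_add])
      map_smul' := fun a x => hE.ext (fun m => by
        rw [dp_lift, D.dp_smul, RingHom.id_apply, E.dp_smul, dp_lift]) (by
        rw [RingHom.id_apply, _root_.map_smul, point_lift, point_lift, _root_.map_smul])
      left_inv := fun x => hD.ext (fun m => by rw [dp_lift, dp_lift])
        (by rw [point_lift, point_lift])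
      right_inv := fun x => hE.ext (fun m => by rw [dp_lift, dp_lift])
        (by rw [point_lift, point_lift]) }
  naturality f x := hE.ext (fun m => by
    change E.dp (D.lift hE _) m = E.dp (Y.map f (D.lift hE x)) m
    rw [dp_lift, D.dp_map, E.dp_map, dp_lift]) (by
    change Y.point _ (D.lift hE _) = Y.point _ (Y.map f (D.lift hE x))
    rw [point_lift, X.point_map, Y.point_map, point_lift])
  point_app S _ _ x := D.point_lift hE x

theorem dp_iso (hD : D.IsUniversal) {S : Type u} [CommRing S] [Algebra A S] (x : X.pts S) (m : ℕ) :
    E.dp ((iso hE hD).app S x) m = D.dp x m := congrFun (D.dp_lift hE x) m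

end DividedPowers

end

section

variable {A A' : Type u} [CommRing A] [Algebra (ZMod p) A] [CommRing A'] [Algebra (ZMod p) A']

/-- The base change of a homomorphism to `u^* 𝔾ₐ^♯`. -/
def DividedPowers.baseChange {X : PointedGaPerfModule.{u} p A} (f : A →+* A')
    (D : X.DividedPowers) : (X.baseChange f).DividedPowers where
  dp {S} _ _ x m := letI := Algebra.compHom S f; D.dp (S := S) x m
  dp_map {S T} _ _ _ _ g x m :=
    letI := Algebra.compHom S f
    letI := Algebra.compHom T f
    D.dp_map (restrictHom f g) x m
  dp_zero {S} _ _ x := letI := Algebra.compHom S f; D.dp_zero (S := S) x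
  dp_one {S} _ _ x := letI := Algebra.compHom S f; D.dp_one (S := S) x
  dp_mul {S} _ _ x m l := letI := Algebra.compHom S f; D.dp_mul (S := S) x m l
  dp_add {S} _ _ x y m := letI := Algebra.compHom S f; D.dp_add (S := S) x y m
  dp_smul {S} _ _ a x m := letI := Algebra.compHom S f; D.dp_smul (S := S) a x m

/-- Deformations isomorphic to `u^* 𝔾ₐ^♯` are uniquely isomorphic as soon as there is at most one
homomorphism to `u^* 𝔾ₐ^♯`. -/
theorem Deformation.exists_unique_iso {f : A →+* A'} {X₀ : PointedGaPerfModule.{u} p A'}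
    (h₀ : ∀ (D D' : X₀.DividedPowers) {S : Type u} [CommRing S] [Algebra A' S] (x : X₀.pts S)
      (m : ℕ), D.dp x m = D'.dp x m)
    (M N : Deformation f X₀)
    (h : ∀ (D D' : M.X.DividedPowers) {S : Type u} [CommRing S] [Algebra A S] (x : M.X.pts S)
      (m : ℕ), D.dp x m = D'.dp x m)
    {D : M.X.DividedPowers} (hD : D.IsUniversal) {E : N.X.DividedPowers} (hE : E.IsUniversal) :
    ∃ φ : Iso M.X N.X, M.IsCompatible N φ ∧ ∀ ψ : Iso M.X N.X, ψ = φ := by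
  refine ⟨DividedPowers.iso hE hD, ?_, ?_⟩
  · intro S _ _ x
    let := Algebra.compHom S f
    refine (LinearEquiv.eq_symm_apply (N.iso.app S)).1 ?_
    refine hE.ext (fun m => ?_) ?_
    -- Both divided power structures are transported to X₀, where they coincide by uniqueness.
    · refine (DividedPowers.dp_iso hE hD (S := S) x m).trans (Eq.trans ?_
        (h₀ ((D.baseChange f).comap M.iso.symm) ((E.baseChange f).comap N.iso.symm)
          (M.iso.app S x) m))
      exact congrArg (fun y : M.X.pts S => D.dp y m)
        ((M.iso.app S).symm_apply_apply x).symm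
    · refine ((DividedPowers.iso hE hD).point_app S x).trans ?_
      exact (M.iso.point_app S x).symm.trans (N.iso.symm.point_app S _).symm
  · intro ψ
    ext S _ _ x
    refine hE.ext (fun m => ?_) ?_
    · rw [DividedPowers.dp_iso]
      -- Any isomorphism ψ pulls E back to a divided power structure on `M.X`, which must be D.
      exact h (E.comap ψ) D x m
    · rw [Iso.point_app, Iso.point_app]

end

end PointedGaPerfModule

/-! ### Explicit formulas for Witt vector components. -/

section Witt

open MvPolynomial in
-- Over ℤ[σ] the identity may be checked on ghost components after tensoring with ℚ, where it says
-- that a^{p^n} distributes over the n-th Witt polynomial.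
theorem teichmuller_mul_mk_coeff_aux (p : ℕ) [hp : Fact p.Prime] {σ : Type*}
    (a : MvPolynomial σ ℤ) (x : WittVector p (MvPolynomial σ ℤ)) :
    WittVector.teichmuller p a * x = WittVector.mk p fun n => a ^ p ^ n * x.coeff n := by
  apply WittVector.map_injective (map (Int.castRingHom ℚ))
    (map_injective _ Int.cast_injective)
  rw [map_mul, WittVector.map_teichmuller]
  apply (WittVector.ghostMap.bijective_of_invertible p (MvPolynomial σ ℚ)).1
  rw [map_mul]
  ext1 n
  rw [Pi.mul_apply, WittVector.ghostMap_apply, WittVector.ghostMap_apply, WittVector.ghostMap_apply,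
    WittVector.ghostComponent_teichmuller, WittVector.ghostComponent_apply,
    WittVector.ghostComponent_apply, aeval_wittPolynomial, aeval_wittPolynomial, Finset.mul_sum]
  refine Finset.sum_congr rfl fun i hi => ?_
  rw [WittVector.map_coeff, WittVector.map_coeff, WittVector.coeff_mk, map_mul, map_pow, mul_pow,
    ← pow_mul, ← pow_add, Nat.add_sub_cancel' (Nat.lt_succ_iff.1 (Finset.mem_range.1 hi))]
  ring

/-- Every S is a quotient of a polynomial ring over ℤ, where the formula is already known. -/
theorem WittVector.coeff_teichmuller_mul {p : ℕ} [hp : Fact p.Prime] {S : Type*} [CommRing S] (a : S)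
    (x : WittVector p S) (n : ℕ) :
    (WittVector.teichmuller p a * x).coeff n = a ^ p ^ n * x.coeff n := by
  let f : MvPolynomial S ℤ →+* S := (MvPolynomial.aeval (id : S → S)).toRingHom
  have hf (s : S) : f (MvPolynomial.X s) = s := MvPolynomial.aeval_X _ _
  obtain ⟨y, rfl⟩ := WittVector.map_surjective (p := p) f (fun s => ⟨_, hf s⟩) x
  rw [← hf a, ← WittVector.map_teichmuller, ← map_mul, teichmuller_mul_mk_coeff_aux,
    WittVector.map_coeff, WittVector.map_coeff, WittVector.coeff_mk, map_mul, map_pow]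

/-- The first ghost component gives a^p + b^p = (a + b)^p + p·(component 1). In a polynomial ring
over ℤ one may divide by p. -/
theorem WittVector.coeff_one_teichmuller_add {p : ℕ} [hp : Fact p.Prime] {S : Type*} [CommRing S]
    (a b : S) : (WittVector.teichmuller p a + WittVector.teichmuller p b).coeff 1 =
      -∑ k ∈ Finset.Ioo 0 p, a ^ k * b ^ (p - k) * ((p.choose k / p : ℕ) : S) := by
  let f : MvPolynomial S ℤ →+* S := (MvPolynomial.aeval (id : S → S)).toRingHom
  have hf (s : S) : f (MvPolynomial.X s) = s := MvPolynomial.aeval_X _ _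
  have key (x y : MvPolynomial S ℤ) :
      (WittVector.teichmuller p x + WittVector.teichmuller p y).coeff 1 =
        -∑ k ∈ Finset.Ioo 0 p, x ^ k * y ^ (p - k) * ((p.choose k / p : ℕ) : MvPolynomial S ℤ) := by
    have h1 := congrArg (WittVector.ghostComponent 1)
      (rfl : WittVector.teichmuller p x + WittVector.teichmuller p y = _)
    have h2 : (WittVector.teichmuller p x + WittVector.teichmuller p y).coeff 0 = x + y := by
      refine (map_add (WittVector.constantCoeff : WittVector p (MvPolynomial S ℤ) →+* _) _ _).trans ?_
      simp [WittVector.constantCoeff]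
    nth_rewrite 1 [map_add] at h1
    rw [WittVector.ghostComponent_teichmuller, WittVector.ghostComponent_teichmuller,
      WittVector.ghostComponent_apply, aeval_wittPolynomial, Finset.sum_range_succ,
      Finset.sum_range_one, h2, pow_zero, one_mul, pow_one, pow_one, Nat.sub_self, pow_zero,
      pow_one, add_pow_prime_eq' hp.out, add_assoc, left_eq_add,
      ← mul_add] at h1
    have hp0 : (p : MvPolynomial S ℤ) ≠ 0 := by exact_mod_cast hp.out.ne_zero
    exact eq_neg_of_add_eq_zero_right ((mul_eq_zero.1 h1).resolve_left hp0)
  rw [← hf a, ← hf b, ← WittVector.map_teichmuller, ← WittVector.map_teichmuller, ← map_add,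
    WittVector.map_coeff, key, map_neg, map_sum]
  simp only [map_mul, map_pow, map_natCast]

end Witt

/-! ### Digits in base p. -/

section Digits

variable (p : ℕ)

/-- The number with digits `e` in base `p`. -/
def digitSum (e : ℕ →₀ ℕ) : ℕ := e.sum fun i n => n * p ^ i

/-- The digits of `m` in base `p`. -/
noncomputable def baseDigits [hp : Fact p.Prime] (m : ℕ) : ℕ →₀ ℕ :=
  Finsupp.onFinset (Finset.range m) (fun i => m / p ^ i % p) fun i hi => by
    rw [Finset.mem_range]
    by_contra h
    apply hi
    rw [Nat.div_eq_of_lt, Nat.zero_mod]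
    exact (not_lt.1 h).trans_lt (Nat.lt_pow_self hp.out.one_lt)

variable {p}

theorem digitSum_single (i n : ℕ) : digitSum p (Finsupp.single i n) = n * p ^ i :=
  Finsupp.sum_single_index (by simp)

variable [hp : Fact p.Prime]

theorem baseDigits_lt (m i : ℕ) : baseDigits p m i < p := Nat.mod_lt _ hp.out.pos

theorem digitSum_baseDigits (m : ℕ) : digitSum p (baseDigits p m) = m := by
  have h (n : ℕ) : ∑ i ∈ Finset.range n, m / p ^ i % p * p ^ i = m % p ^ n := by
    induction n with
    | zero => simp [Nat.mod_one]
    | succ n ih => rw [Finset.sum_range_succ, ih, Nat.mod_pow_succ, mul_comm (_ % p)]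
  rw [digitSum, baseDigits, Finsupp.onFinset_sum _ (by simp), h,
    Nat.mod_eq_of_lt (Nat.lt_pow_self hp.out.one_lt)]

/-- The induction removes the lowest digit and shifts the sequence, so e is quantified inside. -/
theorem digit_sum_range (N : ℕ) : ∀ (e : ℕ → ℕ), (∀ i, e i < p) → ∀ j,
    (∑ i ∈ Finset.range N, e i * p ^ i) / p ^ j % p = if j < N then e j else 0 := by
  induction N with
  | zero => intro e _ j; simp
  | succ N ih =>
    intro e he j
    have h1 : ∑ i ∈ Finset.range (N + 1), e i * p ^ i =
        e 0 + p * ∑ i ∈ Finset.range N, e (i + 1) * p ^ i := by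
      rw [Finset.sum_range_succ', Finset.mul_sum, add_comm, pow_zero, mul_one]
      congr 1
      exact Finset.sum_congr rfl fun i _ => by rw [pow_succ]; ring
    rw [h1]
    cases j with
    | zero => rw [pow_zero, Nat.div_one, Nat.add_mul_mod_self_left, Nat.mod_eq_of_lt (he 0)]; simp
    | succ j =>
      rw [pow_succ', ← Nat.div_div_eq_div_mul, Nat.add_mul_div_left _ _ hp.out.pos,
        Nat.div_eq_of_lt (he 0), zero_add, ih (fun i => e (i + 1)) (fun i => he _)]
      simp

theorem baseDigits_digitSum {e : ℕ →₀ ℕ} (he : ∀ i, e i < p) :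
    baseDigits p (digitSum p e) = e := by
  ext j
  obtain ⟨N, hN⟩ := Finset.exists_nat_subset_range e.support
  have h : digitSum p e = ∑ i ∈ Finset.range N, e i * p ^ i :=
    Finsupp.sum_of_support_subset _ hN _ (by simp)
  change digitSum p e / p ^ j % p = e j
  rw [h, digit_sum_range N e he]
  split_ifs with hj
  · rfl
  · by_contra h0
    exact hj (Finset.mem_range.1 (hN (Finsupp.mem_support_iff.2 (Ne.symm h0))))

theorem baseDigits_of_lt {m : ℕ} (hm : m < p) : baseDigits p m = Finsupp.single 0 m := by
  have h := baseDigits_digitSum (p := p) (e := Finsupp.single 0 m) fun i => by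
    rw [Finsupp.single_apply]
    split_ifs
    · exact hm
    · exact hp.out.pos
  rwa [digitSum_single, pow_zero, mul_one] at h

end Digits

/-! ### A test ring -/

open NonnegPAdicFrac AddMonoidAlgebra

/-- The ideal `(z₀ ^ p, z₁ ^ p, …)` of `𝔽_p[z₀^{1/p^∞}, z₁^{1/p^∞}, …]`. -/
noncomputable def truncationIdeal (p : ℕ) [hp : Fact p.Prime] :
    Ideal (AddMonoidAlgebra (ZMod p) (ℕ →₀ NonnegPAdicFrac p)) :=
  Ideal.span (of' _ _ '' Set.range fun i => Finsupp.single i (nat p p))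

/-- The ring `𝔽_p[z₀^{1/p^∞}, z₁^{1/p^∞}, …] / (z₀ ^ p, z₁ ^ p, …)`. -/
abbrev TruncatedPerfect (p : ℕ) [hp : Fact p.Prime] : Type :=
  AddMonoidAlgebra (ZMod p) (ℕ →₀ NonnegPAdicFrac p) ⧸ truncationIdeal p

namespace TruncatedPerfect

variable {p : ℕ} [hp : Fact p.Prime]

/-- The class of a monomial. -/
noncomputable def monomial (m : ℕ →₀ NonnegPAdicFrac p) : TruncatedPerfect p :=
  Ideal.Quotient.mk _ (single m 1)

theorem monomial_mul (m n : ℕ →₀ NonnegPAdicFrac p) :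
    monomial m * monomial n = monomial (m + n) := by
  rw [monomial, monomial, ← map_mul, single_mul_single, one_mul]
  rfl

theorem monomial_zero : (monomial 0 : TruncatedPerfect p) = 1 := map_one _

theorem monomial_pow (m : ℕ →₀ NonnegPAdicFrac p) (k : ℕ) :
    monomial m ^ k = monomial (k • m) := by
  rw [monomial, ← map_pow, single_pow, one_pow]
  rfl

/-- The element `zᵢ^♭`. -/
noncomputable def tiltVar (i : ℕ) (h : (p : TruncatedPerfect p) = 0) : tilt p (TruncatedPerfect p) h :=
  ⟨fun n => monomial (Finsupp.single i (frac p 1 n)), fun n => by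
    rw [monomial_pow, Finsupp.smul_single, nsmul_frac, mul_one]
    congr 2
    rw [← frac_mul_pow 1 n 1, one_mul, pow_one]⟩

theorem tiltPow_tiltVar (i : ℕ) (h : (p : TruncatedPerfect p) = 0) (q : NonnegPAdicFrac p) :
    tiltPow (tiltVar i h) q = monomial (Finsupp.single i q) := by
  obtain ⟨m, n, rfl⟩ := exists_eq_frac q
  rw [tiltPow_frac]
  change monomial _ ^ m = _
  rw [monomial_pow, Finsupp.smul_single, nsmul_frac, mul_one]

theorem monomial_eq_zero {m : ℕ →₀ NonnegPAdicFrac p} {i : ℕ} (h : m i = nat p p) :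
    (monomial m : TruncatedPerfect p) = 0 := by
  refine Ideal.Quotient.eq_zero_iff_mem.2 (mem_ideal_span_of'_image.2 ?_)
  intro n hn
  have := Finsupp.support_single_subset hn
  rw [Finset.mem_singleton] at this
  subst this
  refine ⟨_, ⟨i, rfl⟩, n.erase i, ?_⟩
  rw [← h, Finsupp.erase_add_single]

/-- The monomials all of whose exponents are less than `p` are linearly independent. -/
theorem coeff_eq_zero {y : AddMonoidAlgebra (ZMod p) (ℕ →₀ NonnegPAdicFrac p)}
    (hy : Ideal.Quotient.mk (truncationIdeal p) y = 0) {m : ℕ →₀ NonnegPAdicFrac p}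
    (hm : ∀ i, (m i : ℚ≥0) < p) : y.coeff m = 0 := by
  by_contra h
  obtain ⟨_, ⟨i, rfl⟩, d, hd⟩ := mem_ideal_span_of'_image.1 (Ideal.Quotient.eq_zero_iff_mem.1 hy) m
    (Finsupp.mem_support_iff.2 h)
  have h1 := hm i
  rw [hd, Finsupp.add_apply, Finsupp.single_eq_same] at h1
  refine absurd h1 (not_lt.2 ?_)
  change (p : ℚ≥0) ≤ (d i : ℚ≥0) + (nat p p : ℚ≥0)
  rw [coe_nat]
  exact le_add_of_nonneg_left zero_le

end TruncatedPerfect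

/-! ### Functions on u^*W[F]: the monomial basis and the failure of additivity. -/

open NonnegPAdicFrac AddMonoidAlgebra

namespace perfWittFrobeniusKernel

variable {p : ℕ} [hp : Fact p.Prime] {S T : Type} [CommRing S] [Algebra (ZMod p) S]
  [CommRing T] [Algebra (ZMod p) T]

/-- The component in `W[F]` of a point of `u^* W[F]`. -/
def witt (x : (perfWittFrobeniusKernel p).pts S) : WittKer p S :=
  (show pullbackPts p (wittFrobeniusKernel p (ZMod p)) S from x).1.1

/-- The Witt vector components of a point of `u^* W[F]`. -/
noncomputable def coeff (x : (perfWittFrobeniusKernel p).pts S) (i : ℕ) : S :=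
  (WittKer.val (witt x)).coeff i

/-- The point of `u^* W[F]` with given components. -/
def mk (w : WittKer p S) (a : tilt p S (natCast_eq_zero_of_algebra p (ZMod p) S))
    (h : (WittKer.val w).coeff 0 = a.1 0) : (perfWittFrobeniusKernel p).pts S :=
  (show pullbackPts p (wittFrobeniusKernel p (ZMod p)) S from ⟨(w, a), h⟩)

theorem pts_ext {x y : (perfWittFrobeniusKernel p).pts S} (h : ∀ i, coeff x i = coeff y i)
    (h' : (perfWittFrobeniusKernel p).point S x = (perfWittFrobeniusKernel p).point S y) : x = y :=
  pullbackPts.ext (WittKer.val_injective (WittVector.ext h)) h'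

theorem coeff_zero (x : (perfWittFrobeniusKernel p).pts S) :
    coeff x 0 = ((perfWittFrobeniusKernel p).point S x).1 0 :=
  (show pullbackPts p (wittFrobeniusKernel p (ZMod p)) S from x).2

theorem coeff_smul (a : tilt p S (natCast_eq_zero_of_algebra p (ZMod p) S))
    (x : (perfWittFrobeniusKernel p).pts S) (i : ℕ) :
    coeff (a • x) i = a.1 0 ^ p ^ i * coeff x i :=
  WittVector.coeff_teichmuller_mul _ _ _

theorem coeff_add (x y : (perfWittFrobeniusKernel p).pts S) (i : ℕ) :
    coeff (x + y) i = (WittKer.val (witt x) + WittKer.val (witt y)).coeff i := rfl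

theorem frobenius_eq_zero_iff (w : WittVector p S) :
    WittVector.frobenius w = 0 ↔ ∀ i, w.coeff i ^ p = 0 := by
  rcases subsingleton_or_nontrivial S with h | h
  · exact ⟨fun _ _ => Subsingleton.elim _ _, fun _ => WittVector.ext fun _ => Subsingleton.elim _ _⟩
  · have : CharP S p := (CharP.charP_iff_prime_eq_zero Fact.out).2
      (natCast_eq_zero_of_algebra p (ZMod p) S)
    simp [WittVector.ext_iff, WittVector.coeff_frobenius_charP]

theorem coeff_pow (x : (perfWittFrobeniusKernel p).pts S) (i : ℕ) : coeff x i ^ p = 0 :=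
  (frobenius_eq_zero_iff _).1 (WittKer.frobenius_val (witt x)) i

section Basis

variable {B : Type} [CommRing B] [Algebra (ZMod p) B]
  (R : (perfWittFrobeniusKernel p).Representation B)

/-- The monomial functions `a ^ q * ∏ i, xᵢ ^ e i` of a point `((x₀, x₁, …), a)`. -/
noncomputable def monomial (x : (perfWittFrobeniusKernel p).pts S) (q : NonnegPAdicFrac p)
    (e : ℕ →₀ ℕ) : S :=
  tiltPow ((perfWittFrobeniusKernel p).point S x) q * e.prod fun i n => coeff x i ^ n

theorem map_monomial (f : S →ₐ[ZMod p] T) (x : (perfWittFrobeniusKernel p).pts S)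
    (q : NonnegPAdicFrac p) (e : ℕ →₀ ℕ) :
    f (monomial x q e) = monomial ((perfWittFrobeniusKernel p).map f x) q e := by
  rw [monomial, monomial, map_mul, PointedGaPerfModule.point_map, map_finsuppProd]
  congr 1
  · exact map_tiltPow f.toRingHom _ _
  · simp only [map_pow]
    rfl

theorem monomial_mul (x : (perfWittFrobeniusKernel p).pts S) (q q' : NonnegPAdicFrac p)
    (e e' : ℕ →₀ ℕ) :
    monomial x q e * monomial x q' e' = monomial x (q + q') (e + e') := by
  rw [monomial, monomial, monomial, mul_mul_mul_comm, tiltPow_add,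
    Finsupp.prod_add_index' (by simp) (by simp [pow_add])]

theorem monomial_zero (x : (perfWittFrobeniusKernel p).pts S) : monomial x 0 0 = 1 := by
  rw [monomial, tiltPow_zero, Finsupp.prod_zero_index, one_mul]

/-- Since x_0 = a_0, integral powers of a can be traded for powers of x_0. -/
theorem monomial_nat_add (x : (perfWittFrobeniusKernel p).pts S) (m : ℕ) (q : NonnegPAdicFrac p)
    (e : ℕ →₀ ℕ) : monomial x (nat p m + q) e = monomial x q (Finsupp.single 0 m + e) := by
  have h : monomial x (nat p m) 0 = monomial x 0 (Finsupp.single 0 m) := by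
    rw [monomial, monomial, tiltPow_nat, tiltPow_zero, Finsupp.prod_zero_index,
      Finsupp.prod_single_index (by simp), coeff_zero, mul_one, one_mul]
  rw [← zero_add e, ← monomial_mul, h, monomial_mul, zero_add, zero_add]

theorem monomial_eq_zero (x : (perfWittFrobeniusKernel p).pts S) (q : NonnegPAdicFrac p)
    {e : ℕ →₀ ℕ} {i : ℕ} (h : p ≤ e i) : monomial x q e = 0 := by
  have h1 : e = Finsupp.single i p + (e - Finsupp.single i p) := by
    rw [add_tsub_cancel_of_le]
    rwa [Finsupp.single_le_iff]
  have h2 : monomial x 0 (Finsupp.single i p) = 0 := by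
    rw [monomial, Finsupp.prod_single_index (by simp), coeff_pow, mul_zero]
  rw [h1, ← zero_add q, ← monomial_mul, h2, zero_mul]

theorem monomial_smul (a : tilt p S (natCast_eq_zero_of_algebra p (ZMod p) S))
    (x : (perfWittFrobeniusKernel p).pts S) (q : NonnegPAdicFrac p) (e : ℕ →₀ ℕ) :
    monomial (a • x) q e = tiltPow a (nat p (digitSum p e) + q) * monomial x q e := by
  have h : (e.prod fun i n => coeff (a • x) i ^ n) =
      a.1 0 ^ digitSum p e * e.prod fun i n => coeff x i ^ n := by
    rw [digitSum, Finsupp.sum, ← Finset.prod_pow_eq_pow_sum, Finsupp.prod, Finsupp.prod,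
      ← Finset.prod_mul_distrib]
    refine Finset.prod_congr rfl fun i _ => ?_
    rw [coeff_smul, mul_pow, ← pow_mul, mul_comm (p ^ i)]
  rw [monomial, monomial, h, map_smul, smul_eq_mul, tiltPow_mul, tiltPow_add, tiltPow_nat]
  ring

/-- The unique monomial of degree `q` with all exponents less than `p`. -/
noncomputable def reducedMonomial (x : (perfWittFrobeniusKernel p).pts S) (q : NonnegPAdicFrac p) :
    S := monomial x (fract q) (baseDigits p (floor q))

theorem map_reducedMonomial (f : S →ₐ[ZMod p] T) (x : (perfWittFrobeniusKernel p).pts S)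
    (q : NonnegPAdicFrac p) :
    f (reducedMonomial x q) = reducedMonomial ((perfWittFrobeniusKernel p).map f x) q :=
  map_monomial f x _ _

/-- After the integral part of q is moved to x_0, either some exponent reaches p and the monomial
vanishes, or the exponents are the digits of their digit sum. -/
theorem monomial_eq_zero_or (x : (perfWittFrobeniusKernel p).pts S) (q : NonnegPAdicFrac p)
    (e : ℕ →₀ ℕ) : monomial x q e = 0 ∨ ∃ r, monomial x q e = reducedMonomial x r := by
  have h := monomial_nat_add x (floor q) (fract q) e
  rw [nat_floor_add_fract] at h
  rw [h]
  by_cases h1 : ∃ i, p ≤ (Finsupp.single 0 (floor q) + e : ℕ →₀ ℕ) i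
  · obtain ⟨i, hi⟩ := h1
    exact Or.inl (monomial_eq_zero x _ hi)
  · push Not at h1
    refine Or.inr ⟨nat p (digitSum p (Finsupp.single 0 (floor q) + e)) + fract q, ?_⟩
    rw [reducedMonomial, floor_nat_add (fract_lt_one q), fract_nat_add (fract_lt_one q),
      baseDigits_digitSum h1]

theorem reducedMonomial_of_le_one (x : (perfWittFrobeniusKernel p).pts S) {q : NonnegPAdicFrac p}
    (hq : (q : ℚ≥0) ≤ 1) :
    reducedMonomial x q = tiltPow ((perfWittFrobeniusKernel p).point S x) q := by
  have h : floor q < p := by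
    refine lt_of_le_of_lt ?_ hp.out.one_lt
    exact Nat.floor_le_one_of_le_one hq
  have h1 := monomial_nat_add x (floor q) (fract q) 0
  rw [nat_floor_add_fract, add_zero] at h1
  rw [reducedMonomial, baseDigits_of_lt h, ← h1, monomial, Finsupp.prod_zero_index, mul_one]

theorem reducedMonomial_pow (x : (perfWittFrobeniusKernel p).pts S) (n : ℕ) :
    reducedMonomial x (nat p (p ^ n)) = coeff x n := by
  have h : baseDigits p (p ^ n) = Finsupp.single n 1 := by
    have := baseDigits_digitSum (p := p) (e := Finsupp.single n 1) fun i => by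
      rw [Finsupp.single_apply]
      split_ifs
      · exact hp.out.one_lt
      · exact hp.out.pos
    rwa [digitSum_single, one_mul] at this
  rw [reducedMonomial, fract_nat, floor_nat, h, monomial, tiltPow_zero,
    Finsupp.prod_single_index (by simp), pow_one, one_mul]

theorem classify_reducedMonomial (x : (perfWittFrobeniusKernel p).pts S) (q : NonnegPAdicFrac p) :
    R.classify x (reducedMonomial R.point q) = reducedMonomial x q := by
  rw [map_reducedMonomial, R.map_classify]

theorem isHomogeneous_reducedMonomial (q : NonnegPAdicFrac p) :
    R.IsHomogeneous q (reducedMonomial R.point q) := by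
  apply R.isHomogeneous_of_forall
  intro S _ _ s x
  rw [classify_reducedMonomial, classify_reducedMonomial, reducedMonomial, monomial_smul,
    digitSum_baseDigits, nat_floor_add_fract]
  rfl

/-- The monomials span a subalgebra B' containing all components of the universal point, which
therefore comes from a point over B'. Its classifying map B → B', followed by the inclusion, is the
identity of B, so B' = B. -/
theorem span_reducedMonomial :
    Submodule.span (ZMod p) (Set.range (reducedMonomial R.point)) = ⊤ := by
  let P := perfWittFrobeniusKernel p
  let N : Submonoid B :=
    { carrier := Set.range fun qe : NonnegPAdicFrac p × (ℕ →₀ ℕ) => monomial R.point qe.1 qe.2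
      one_mem' := ⟨(0, 0), monomial_zero _⟩
      mul_mem' := by
        rintro _ _ ⟨⟨q, e⟩, rfl⟩ ⟨⟨q', e'⟩, rfl⟩
        exact ⟨(q + q', e + e'), (monomial_mul _ _ _ _ _).symm⟩ }
  have hN : Submodule.span (ZMod p) (N : Set B) ≤
      Submodule.span (ZMod p) (Set.range (reducedMonomial R.point)) := by
    rw [Submodule.span_le]
    rintro _ ⟨⟨q, e⟩, rfl⟩
    change monomial R.point q e ∈ _
    rcases monomial_eq_zero_or R.point q e with h | ⟨r, h⟩
    · rw [h]; exact Submodule.zero_mem _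
    · rw [h]; exact Submodule.subset_span ⟨r, rfl⟩
  let B' : Subalgebra (ZMod p) B := Algebra.adjoin (ZMod p) N
  have hB' : (B' : Set B) = Submodule.span (ZMod p) (N : Set B) := by
    have : (Algebra.adjoin (ZMod p) (N : Set B)).toSubmodule =
        Submodule.span (ZMod p) (N : Set B) := by
      rw [Algebra.adjoin_eq_span, Submonoid.closure_eq]
    exact congrArg (fun M : Submodule (ZMod p) B => (M : Set B)) this
  have hmem (q : NonnegPAdicFrac p) (e : ℕ →₀ ℕ) : monomial R.point q e ∈ B' :=
    Algebra.subset_adjoin ⟨(q, e), rfl⟩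
  have hcoeff (i : ℕ) : coeff R.point i ∈ B' := by
    have := hmem 0 (Finsupp.single i 1)
    rwa [monomial, tiltPow_zero, one_mul, Finsupp.prod_single_index (by simp), pow_one] at this
  have hpt (n : ℕ) : (P.point B R.point).1 n ∈ B' := by
    have := hmem (frac p 1 n) 0
    rwa [monomial, tiltPow_frac, Finsupp.prod_zero_index, mul_one, pow_one] at this
  let x' : P.pts B' := mk (WittKer.mk (WittVector.mk p fun i => ⟨coeff R.point i, hcoeff i⟩)
    ((frobenius_eq_zero_iff _).2 fun i => Subtype.ext (coeff_pow R.point i)))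
    ⟨fun n => ⟨(P.point B R.point).1 n, hpt n⟩, fun n => Subtype.ext ((P.point B R.point).2 n)⟩
    (Subtype.ext (coeff_zero R.point))
  have hx' : P.map B'.val x' = R.point := by
    apply pts_ext
    · intro i; rfl
    · rfl
  have h1 : B'.val.comp (R.classify x') = AlgHom.id _ B := by
    rw [← R.classify_map, hx', R.classify_point]
  rw [eq_top_iff]
  intro b _
  apply hN
  have h2 : B'.val (R.classify x' b) = b := AlgHom.congr_fun h1 b
  have h3 : b ∈ (B' : Set B) := by
    rw [← h2]; exact (R.classify x' b).2
  rw [hB'] at h3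
  exact h3

/-- The point of `u^* W[F]` over the test ring with Witt components `z₀, z₁, …`. -/
noncomputable def testPoint (p : ℕ) [hp : Fact p.Prime] :
    (perfWittFrobeniusKernel p).pts (TruncatedPerfect p) :=
  mk (WittKer.mk (WittVector.mk p fun i => TruncatedPerfect.monomial (Finsupp.single i (nat p 1)))
    ((frobenius_eq_zero_iff _).2 fun i => by
      rw [WittVector.coeff_mk, TruncatedPerfect.monomial_pow]
      apply TruncatedPerfect.monomial_eq_zero (i := i)
      rw [Finsupp.smul_apply, Finsupp.single_eq_same, nat, nsmul_frac, mul_one, nat]))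
    (TruncatedPerfect.tiltVar 0 _) rfl

/-- The exponent of the value of a monomial at `testPoint`. -/
noncomputable def testExponent (q : NonnegPAdicFrac p) (e : ℕ →₀ ℕ) : ℕ →₀ NonnegPAdicFrac p :=
  Finsupp.single 0 q + e.mapRange (nat p) nat_zero

theorem monomial_testPoint (q : NonnegPAdicFrac p) (e : ℕ →₀ ℕ) :
    monomial (testPoint p) q e = TruncatedPerfect.monomial (testExponent q e) := by
  have h : (e.prod fun i n => coeff (testPoint p) i ^ n) =
      TruncatedPerfect.monomial (e.mapRange (nat p) nat_zero) := by
    induction e using Finsupp.induction_linear with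
    | zero => rw [Finsupp.prod_zero_index, Finsupp.mapRange_zero, TruncatedPerfect.monomial_zero]
    | add f g hf hg =>
      rw [Finsupp.prod_add_index' (by simp) (by simp [pow_add]), hf, hg,
        TruncatedPerfect.monomial_mul, Finsupp.mapRange_add (by exact nat_add)]
    | single i n =>
      rw [Finsupp.prod_single_index (by simp), Finsupp.mapRange_single]
      change TruncatedPerfect.monomial (Finsupp.single i (nat p 1)) ^ n = _
      rw [TruncatedPerfect.monomial_pow, Finsupp.smul_single, nat, nsmul_frac, mul_one, nat]
  rw [monomial, h, testExponent, ← TruncatedPerfect.monomial_mul]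
  congr 1
  exact TruncatedPerfect.tiltPow_tiltVar _ _ _

/-- At `testPoint` the reduced monomials become distinct monomials in the z_i with all exponents
below p: z_0 carries the fractional part and the lowest digit, z_i the digit of index i. -/
theorem linearIndependent_reducedMonomial :
    LinearIndependent (ZMod p) (reducedMonomial R.point) := by
  let E (q : NonnegPAdicFrac p) : ℕ →₀ NonnegPAdicFrac p :=
    testExponent (fract q) (baseDigits p (floor q))
  have hE0 (q) : E q 0 = nat p (baseDigits p (floor q) 0) + fract q := by
    simp [E, testExponent, add_comm]
  have hE1 (q) (i : ℕ) (hi : i ≠ 0) : E q i = nat p (baseDigits p (floor q) i) := by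
    simp [E, testExponent, hi]
  have hinj : Function.Injective E := by
    intro q r h
    have h0 : fract q = fract r := by
      rw [← fract_nat_add (m := baseDigits p (floor q) 0) (fract_lt_one q), ← hE0, h, hE0,
        fract_nat_add (fract_lt_one r)]
    have h1 : baseDigits p (floor q) = baseDigits p (floor r) := by
      ext i
      by_cases hi : i = 0
      · subst hi
        rw [← floor_nat_add (m := baseDigits p (floor q) 0) (fract_lt_one q), ← hE0, h, hE0,
          floor_nat_add (fract_lt_one r)]
      · apply nat_injective (p := p)
        rw [← hE1 _ _ hi, ← hE1 _ _ hi, h]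
    rw [← nat_floor_add_fract q, ← nat_floor_add_fract r, h0, ← digitSum_baseDigits (p := p) (floor q),
      h1, digitSum_baseDigits]
  have hlt (q) (i : ℕ) : (E q i : ℚ≥0) < p := by
    have h : baseDigits p (floor q) i + 1 ≤ p := baseDigits_lt _ _
    by_cases hi : i = 0
    · subst hi
      rw [hE0]
      change (nat p _ : ℚ≥0) + (fract q : ℚ≥0) < p
      rw [coe_nat]
      refine lt_of_lt_of_le ((add_lt_add_iff_left _).2 (fract_lt_one q)) ?_
      exact_mod_cast h
    · rw [hE1 _ _ hi, coe_nat]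
      exact_mod_cast h
  rw [linearIndependent_iff]
  intro c hc
  have h1 := congrArg (R.classify (testPoint p)) hc
  rw [map_zero, Finsupp.linearCombination_apply, Finsupp.sum, map_sum] at h1
  have h2 : Ideal.Quotient.mk (truncationIdeal p) (ofCoeff (c.mapDomain E)) = 0 := by
    rw [← h1, Finsupp.mapDomain, Finsupp.sum, AddMonoidAlgebra.ofCoeff_sum, map_sum]
    refine Finset.sum_congr rfl fun q _ => ?_
    rw [map_smul, classify_reducedMonomial, reducedMonomial, monomial_testPoint]
    change Ideal.Quotient.mk _ (single (E q) (c q)) = c q • Ideal.Quotient.mk _ (single (E q) 1)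
    rw [← mul_one (c q), ← smul_eq_mul, ← smul_single, smul_eq_mul, mul_one]
    rfl
  ext q
  have h3 := TruncatedPerfect.coeff_eq_zero h2 (hlt q)
  rwa [coeff_ofCoeff, Finsupp.mapDomain_apply hinj] at h3

/-- The homogeneous basis of the functions on `u^* W[F]` consisting of monomials. -/
noncomputable def homogeneousBasis : R.HomogeneousBasis where
  basis := Module.Basis.mk (linearIndependent_reducedMonomial R) (span_reducedMonomial R).ge
  homogeneous q := by rw [Module.Basis.mk_apply]; exact isHomogeneous_reducedMonomial R q
  eq_tiltPow q hq := by rw [Module.Basis.mk_apply]; exact reducedMonomial_of_le_one _ hq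

theorem homogeneousBasis_basis (q : NonnegPAdicFrac p) :
    (homogeneousBasis R).basis q = reducedMonomial R.point q :=
  Module.Basis.mk_apply (linearIndependent_reducedMonomial R) (span_reducedMonomial R).ge q

end Basis

/-- The Witt vector components of positive index are not additive on `u^* W[F]`. -/
theorem exists_coeff_add_ne (p : ℕ) [hp : Fact p.Prime] (m : ℕ) :
    ∃ x y : (perfWittFrobeniusKernel p).pts (TruncatedPerfect p),
      coeff (x + y) (m + 1) ≠ coeff x (m + 1) + coeff y (m + 1) := by
  let P := perfWittFrobeniusKernel p
  let z (i : ℕ) : TruncatedPerfect p := TruncatedPerfect.monomial (Finsupp.single i (nat p 1))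
  -- The shift V^m moves the first carry of [z_0] + [z_1] to component m + 1, where both summands
  -- are 0.
  let w (i : ℕ) : WittVector p (TruncatedPerfect p) :=
    WittVector.verschiebung^[m] (WittVector.teichmuller p (z i))
  have hz (i : ℕ) : z i ^ p = 0 := by
    rw [TruncatedPerfect.monomial_pow]
    apply TruncatedPerfect.monomial_eq_zero (i := i)
    rw [Finsupp.smul_apply, Finsupp.single_eq_same, nat, nsmul_frac, mul_one, nat]
  have hw (i : ℕ) : WittVector.frobenius (w i) = 0 := by
    rw [frobenius_eq_zero_iff]
    intro k
    rcases lt_or_ge k m with hk | hk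
    · rw [WittVector.iterate_verschiebung_coeff_eq_zero _ hk]
      exact zero_pow (M₀ := TruncatedPerfect p) hp.out.ne_zero
    · obtain ⟨k, rfl⟩ := Nat.exists_eq_add_of_le' hk
      rw [WittVector.iterate_verschiebung_coeff]
      rcases Nat.eq_zero_or_pos k with rfl | hk
      · rw [WittVector.teichmuller_coeff_zero, hz]
      · rw [WittVector.teichmuller_coeff_pos _ _ _ hk]
        exact zero_pow (M₀ := TruncatedPerfect p) hp.out.ne_zero
  -- Only the zeroth component has to lift to the tilt; it is z_i for m = 0 and 0 otherwise.
  have ha (i : ℕ) : ∃ a : tilt p (TruncatedPerfect p) (natCast_eq_zero_of_algebra p (ZMod p) _),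
      (WittKer.val (WittKer.mk (w i) (hw i))).coeff 0 = a.1 0 := by
    rcases Nat.eq_zero_or_pos m with rfl | hm
    · exact ⟨TruncatedPerfect.tiltVar i _, WittVector.teichmuller_coeff_zero _ _⟩
    · exact ⟨0, WittVector.iterate_verschiebung_coeff_eq_zero _ hm⟩
  choose a ha using ha
  refine ⟨mk (WittKer.mk (w 0) (hw 0)) (a 0) (ha 0), mk (WittKer.mk (w 1) (hw 1)) (a 1) (ha 1), ?_⟩
  have h0 (i : ℕ) : (w i).coeff (m + 1) = 0 := by
    rw [add_comm, WittVector.iterate_verschiebung_coeff]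
    exact WittVector.teichmuller_coeff_pos _ _ _ one_pos
  have h1 : w 0 + w 1 = WittVector.verschiebung^[m] (WittVector.teichmuller p (z 0) +
      WittVector.teichmuller p (z 1)) := (iterate_map_add _ _ _ _).symm
  rw [coeff_add]
  change (w 0 + w 1).coeff (m + 1) ≠ (w 0).coeff (m + 1) + (w 1).coeff (m + 1)
  rw [h0, h0, h1, add_comm m 1, WittVector.iterate_verschiebung_coeff,
    WittVector.coeff_one_teichmuller_add, add_zero, Ne, neg_eq_zero]
  let E (k : ℕ) : ℕ →₀ NonnegPAdicFrac p :=
    Finsupp.single 0 (nat p k) + Finsupp.single 1 (nat p (p - k))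
  let y : AddMonoidAlgebra (ZMod p) (ℕ →₀ NonnegPAdicFrac p) :=
    ∑ k ∈ Finset.Ioo 0 p, single (E k) ((p.choose k / p : ℕ) : ZMod p)
  have hy : ∑ k ∈ Finset.Ioo 0 p, z 0 ^ k * z 1 ^ (p - k) *
      ((p.choose k / p : ℕ) : TruncatedPerfect p) = Ideal.Quotient.mk (truncationIdeal p) y := by
    rw [map_sum]
    refine Finset.sum_congr rfl fun k _ => ?_
    rw [TruncatedPerfect.monomial_pow, TruncatedPerfect.monomial_pow,
      TruncatedPerfect.monomial_mul, Finsupp.smul_single, Finsupp.smul_single, nat, nsmul_frac,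
      nsmul_frac, mul_one, mul_one, ← map_natCast (Ideal.Quotient.mk (truncationIdeal p)),
      TruncatedPerfect.monomial, ← map_mul, natCast_def, single_mul_single, add_zero, one_mul]
    rfl
  rw [hy]
  intro hy0
  have hp1 := hp.out.one_lt
  -- The carry contains z_0 z_1^{p-1} with coefficient p / p = 1, and its exponents are below p.
  have h2 := TruncatedPerfect.coeff_eq_zero hy0 (m := E 1) (by
    intro i
    simp only [E, Finsupp.add_apply, Finsupp.single_apply]
    split_ifs with h h' h'
    · omega
    · rw [add_zero, coe_nat]; exact_mod_cast hp1
    · rw [zero_add, coe_nat]; exact_mod_cast (by omega : p - 1 < p)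
    · rw [add_zero]
      change (0 : ℚ≥0) < p
      exact_mod_cast hp.out.pos)
  rw [AddMonoidAlgebra.coeff_sum, Finsupp.finsetSum_apply, Finset.sum_eq_single 1] at h2
  · rw [coeff_single, Finsupp.single_eq_same, Nat.choose_one_right,
      Nat.div_self hp.out.pos, Nat.cast_one] at h2
    exact one_ne_zero h2
  · intro k _ hk
    rw [coeff_single, Finsupp.single_eq_of_ne]
    intro h
    have h3 := DFunLike.congr_fun h 0
    simp only [E, Finsupp.add_apply, Finsupp.single_eq_same, Finsupp.single_apply, one_ne_zero,
      if_false, add_zero] at h3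
    exact hk (nat_injective h3).symm
  · intro h
    exact absurd (Finset.mem_Ioo.2 ⟨one_pos, hp1⟩) h

end perfWittFrobeniusKernel

/-! ### Lifting bases along a square-zero extension. -/

section

variable {A k : Type*} [CommRing A] [CommRing k] {f : A →+* k} {ε : A}
  (h₁ : ∀ a, ε * a = 0 ↔ f a = 0) (h₂ : ∀ a, f a = 0 ↔ ∃ c, a = ε * c)
  {M N : Type*} [AddCommGroup M] [Module A M] [AddCommGroup N] [Module k N]
  {π : M →ₛₗ[f] N} (h₃ : ∀ m, π m = 0 ↔ ∃ m', m = ε • m')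
  {ι : Type*} {v : ι → M}

include h₁ h₂ in
-- Equational criterion for flatness: m = ∑ a_j y_j with ε a_j = 0, and an element of A killed by ε
-- is a multiple of ε.
theorem Module.Flat.exists_eq_smul_of_smul_eq_zero [Module.Flat A M] {m : M} (hm : ε • m = 0) :
    ∃ m', m = ε • m' := by
  have h := Module.Flat.isTrivialRelation_of_sum_smul_eq_zero (R := A) (ι := Unit) (f := fun _ => ε) (x := fun _ => m)
    (by simpa using hm)
  obtain ⟨κ, a, y, hy, ha⟩ := h
  have h' : ∀ j, ∃ c, a () j = ε * c := by
    intro j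
    rw [← h₂, ← h₁]
    simpa using ha j
  choose c hc using h'
  refine ⟨∑ j, c j • y j, ?_⟩
  refine (hy ()).trans ?_
  rw [Finset.smul_sum]
  simp_rw [hc, mul_smul]

include h₁ h₂ h₃ in
/-- A family in a flat module lifting a linearly independent family modulo a square-zero element is
linearly independent. -/
theorem LinearIndependent.of_flat_squareZero [Module.Flat A M]
    (hv : LinearIndependent k fun i => π (v i)) : LinearIndependent A v := by
  have key : ∀ (s : Finset ι) (g : ι → A), π (∑ i ∈ s, g i • v i) = 0 → ∀ i ∈ s, f (g i) = 0 := by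
    intro s g hg
    rw [map_sum] at hg
    simp_rw [map_smulₛₗ] at hg
    exact linearIndependent_iff'.1 hv s _ hg
  rw [linearIndependent_iff']
  intro s g hg
  have hc : ∀ i, ∃ c, i ∈ s → g i = ε * c := by
    intro i
    by_cases hi : i ∈ s
    · obtain ⟨c, hc⟩ := (h₂ _).1 (key s g (by rw [hg, map_zero]) i hi)
      exact ⟨c, fun _ => hc⟩
    · exact ⟨0, fun h => absurd h hi⟩
  choose c hc using hc
  -- The coefficients are ε c_i. By flatness ∑ c_i v_i lies in εM, so independence modulo ε applies
  -- a second time and gives f(c_i) = 0, that is, ε c_i = 0.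
  have h0 : ε • ∑ i ∈ s, c i • v i = 0 := by
    rw [← hg, Finset.smul_sum]
    refine Finset.sum_congr rfl fun i hi => ?_
    rw [hc i hi, mul_smul]
  intro i hi
  rw [hc i hi, h₁]
  exact key s c ((h₃ _).2 (Module.Flat.exists_eq_smul_of_smul_eq_zero h₁ h₂ h0)) i hi

include h₁ h₂ h₃ in
/-- A family lifting generators modulo a square-zero element generates. -/
theorem Submodule.span_range_eq_top_of_squareZero [RingHomSurjective f]
    (hv : Submodule.span k (Set.range fun i => π (v i)) = ⊤) :
    Submodule.span A (Set.range v) = ⊤ := by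
  have hε : ε * ε = 0 := (h₁ ε).2 ((h₂ ε).2 ⟨1, (mul_one ε).symm⟩)
  have key : ∀ m, ∃ n ∈ Submodule.span A (Set.range v), ∃ m', m = n + ε • m' := by
    intro m
    have h : (Submodule.span A (Set.range v)).map π = ⊤ := by
      rw [Submodule.map_span, ← Set.range_comp]
      exact hv
    obtain ⟨n, hn, hnm⟩ := (h ▸ Submodule.mem_top : π m ∈ (Submodule.span A (Set.range v)).map π)
    obtain ⟨m', hm'⟩ := (h₃ (m - n)).1 (by rw [map_sub, hnm, sub_self])
    exact ⟨n, hn, m', by rw [← hm', add_sub_cancel]⟩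
  rw [Submodule.eq_top_iff']
  intro m
  obtain ⟨n, hn, m', rfl⟩ := key m
  -- Applying the approximation to the error term leaves ε² = 0.
  obtain ⟨n', hn', m'', rfl⟩ := key m'
  rw [smul_add, smul_smul, hε, zero_smul, add_zero]
  exact Submodule.add_mem _ hn (Submodule.smul_mem _ _ hn')

end

/-! ### From the special fibre to a deformation. -/

namespace PointedGaPerfModule

open NonnegPAdicFrac AddMonoidAlgebra

variable {p : ℕ} [hp : Fact p.Prime]

namespace Representation.HomogeneousBasis

variable {A : Type u} [CommRing A] [Algebra (ZMod p) A]
  {X : PointedGaPerfModule.{u} p A} {B : Type u} [CommRing B] [Algebra A B]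
  {R : X.Representation B} (H : R.HomogeneousBasis) {S : Type u} [CommRing S] [Algebra A S]

/-- If the structure constants of the comultiplication in degree `d` vanish in `S`, then the basis
element of degree `d` is additive on `S`-points. -/
theorem classify_add_basis {d : NonnegPAdicFrac p} (hd : d ≠ 0)
    (h : ∀ i j, i ≠ 0 → j ≠ 0 → i + j = d → algebraMap A S (H.comulCoeff i j) = 0)
    (x y : X.pts S) : R.classify (x + y) (H.basis d) =
      R.classify x (H.basis d) + R.classify y (H.basis d) := by
  let b := H.basis
  let φ : B ⊗[A] B →ₐ[A] S :=
    Algebra.TensorProduct.lift (R.classify x) (R.classify y) fun _ _ => Commute.all _ _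
  have h1 : ∀ z : B ⊗[A] B, (∀ ij, algebraMap A S ((b.tensorProduct b).repr z ij) = 0) →
      φ z = 0 := by
    intro z hz
    rw [← (b.tensorProduct b).linearCombination_repr z, Finsupp.linearCombination_apply,
      Finsupp.sum, map_sum]
    refine Finset.sum_eq_zero fun ij _ => ?_
    rw [_root_.map_smul, Algebra.smul_def, hz, zero_mul]
  -- The coordinates of this difference are 0, or structure constants of two nonzero degrees adding
  -- up to d.
  have h2 : φ (R.comul (b d) - (b d ⊗ₜ b 0 + b 0 ⊗ₜ b d)) = 0 := by
    refine h1 _ ?_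
    rintro ⟨i, j⟩
    rw [map_sub, map_add, Finsupp.sub_apply, Finsupp.add_apply,
      Module.Basis.tensorProduct_repr_tmul_apply, Module.Basis.tensorProduct_repr_tmul_apply,
      Module.Basis.repr_self, Module.Basis.repr_self]
    by_cases hi : i = 0
    · subst hi
      rw [← R.eval_coord_mul_coord, H.coord_zero, one_mul, R.eval_coord, Module.Basis.repr_self,
        Finsupp.single_eq_of_ne hd.symm, Finsupp.single_eq_same]
      simp
    by_cases hj : j = 0
    · subst hj
      rw [← R.eval_coord_mul_coord, H.coord_zero, mul_one, R.eval_coord, Module.Basis.repr_self,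
        Finsupp.single_eq_of_ne hd.symm, Finsupp.single_eq_same]
      simp
    rw [Finsupp.single_eq_of_ne hi, Finsupp.single_eq_of_ne hj, smul_zero, zero_smul, add_zero,
      sub_zero]
    by_cases hij : i + j = d
    · rw [← R.eval_coord_mul_coord, ← hij]
      exact h i j hi hj hij
    · rw [R.comul_repr_eq_zero H.homogeneous hij, map_zero]
  rw [R.classify_add, AlgHom.comp_apply]
  rw [map_sub, sub_eq_zero, map_add, Algebra.TensorProduct.lift_tmul,
    Algebra.TensorProduct.lift_tmul, H.basis_zero, map_one, map_one, one_mul, mul_one] at h2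
  exact h2

end Representation.HomogeneousBasis

namespace Deformation

variable {A k : Type u} [CommRing A] [Algebra (ZMod p) A] [CommRing k] [Algebra (ZMod p) k]
  {f : A →+* k} {X₀ : PointedGaPerfModule.{u} p k} (D : Deformation f X₀)
  {B : Type u} [CommRing B] [Algebra A B] (R : D.X.Representation B)
  {B₀ : Type u} [CommRing B₀] [Algebra k B₀]
  (π : letI := Algebra.compHom B₀ f; B →ₐ[A] B₀)

section

variable (hf : Function.Surjective f) (hπ : Function.Surjective π)
  (hker : RingHom.ker π ≤ (RingHom.ker f).map (algebraMap A B))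

/-- The representation of the special fibre induced by a representation of a deformation. -/
def specialFibre : X₀.Representation B₀ where
  point := letI := Algebra.compHom B₀ f; D.iso.app B₀ (D.X.map π R.point)
  existsUnique S _ _ x := by
    let := Algebra.compHom B₀ f
    let := Algebra.compHom S f
    let y : D.X.pts S := (D.iso.app S).symm x
    have hy : D.iso.app S y = x := (D.iso.app S).apply_symm_apply x
    have key (h : B₀ →ₐ[k] S) : X₀.map h (D.iso.app B₀ (D.X.map π R.point)) = x ↔
        (restrictHom f h).comp π = R.classify y := by
      have e : X₀.map h (D.iso.app B₀ (D.X.map π R.point)) =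
          D.iso.app S (D.X.map ((restrictHom f h).comp π) R.point) := by
        rw [D.X.map_comp]
        exact (D.iso.naturality h (D.X.map π R.point)).symm
      rw [e, ← hy]
      constructor
      · intro h'
        exact (R.classify_eq ((D.iso.app S).injective h')).symm
      · intro h'
        exact congrArg (D.iso.app S) (by rw [h', R.map_classify])
    -- As S is an A-algebra through f, every A-algebra map from B to S kills the ideal generated by
    -- the kernel of f.
    have hg : RingHom.ker π ≤ RingHom.ker (R.classify y) := by
      refine hker.trans ?_
      rw [Ideal.map_le_iff_le_comap]
      intro a ha
      change R.classify y (algebraMap A B a) = 0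
      rw [AlgHom.commutes]
      change algebraMap k S (f a) = 0
      rw [ha, map_zero]
    let g : B₀ →+* S := RingHom.liftOfSurjective π.toRingHom hπ ⟨(R.classify y).toRingHom, hg⟩
    have hgπ (b : B) : g (π b) = R.classify y b :=
      RingHom.liftOfRightInverse_comp_apply π.toRingHom _ _ ⟨(R.classify y).toRingHom, hg⟩ b
    let h : B₀ →ₐ[k] S :=
      { g with
        commutes' := fun c => by
          obtain ⟨a, rfl⟩ := hf c
          have e1 : algebraMap k B₀ (f a) = π (algebraMap A B a) := (π.commutes a).symm
          change g (algebraMap k B₀ (f a)) = _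
          rw [e1, hgπ, AlgHom.commutes]
          rfl }
    refine ⟨h, (key h).2 (AlgHom.ext hgπ), fun h' hh' => ?_⟩
    have e := (key h').1 hh'
    ext c
    obtain ⟨b, rfl⟩ := hπ c
    exact (AlgHom.congr_fun e b).trans (hgπ b).symm

theorem classify_specialFibre {S : Type u} [CommRing S] [Algebra k S]
    (x : letI := Algebra.compHom S f; D.X.pts S) (b : B) :
    letI := Algebra.compHom S f
    (D.specialFibre R π hf hπ hker).classify (D.iso.app S x) (π b) = R.classify x b := by
  let := Algebra.compHom B₀ f
  let := Algebra.compHom S f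
  let R₀ := D.specialFibre R π hf hπ hker
  let h := R₀.classify (D.iso.app S x)
  have h1 : D.iso.app S (D.X.map ((restrictHom f h).comp π) R.point) = D.iso.app S x := by
    rw [D.X.map_comp]
    exact (D.iso.naturality h (D.X.map π R.point)).trans (R₀.map_classify _)
  rw [R.classify_eq ((D.iso.app S).injective h1)]
  rfl

/-- The isomorphism with X₀ is linear, so the coaction of B reduces to that of B₀. The coefficient
of t^q in the reduced coaction of b is π(`proj q b`), and homogeneity of π b says that it is π b. -/
theorem proj_specialFibre {q : NonnegPAdicFrac p} {b : B}
    (hb : (D.specialFibre R π hf hπ hker).IsHomogeneous q (π b)) :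
    π (R.proj q b) = π b := by
  let Q := NonnegPAdicFrac p
  let S := AddMonoidAlgebra B₀ Q
  let i₀ := Algebra.compHom B₀ f
  let iS : Algebra A S := Algebra.compHom S f
  let ι : B₀ →ₐ[k] S := singleZeroAlgHom (R := k) (M := Q)
  let g : B →ₐ[A] S := (restrictHom f ι).comp π
  let s := monomialTilt B₀ (AddMonoidHom.id Q) (natCast_eq_zero_of_algebra p k S)
  let x : D.X.pts S := D.X.map g R.point
  have h1 : ∀ y : AddMonoidAlgebra B Q, (Representation.evalTilt g s y).coeff q =
      π (y.coeff q) := by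
    intro y
    induction y using AddMonoidAlgebra.induction_linear with
    | zero => simp
    | add f g hf hg =>
      rw [map_add]
      exact (congrArg₂ (· + ·) hf hg).trans (map_add π _ _).symm
    | single r c =>
      rw [Representation.evalTilt_single, tiltPow_monomialTilt]
      change (single 0 (π c) * single r 1).coeff q = _
      rw [single_mul_single, zero_add, mul_one, coeff_single, coeff_single]
      classical
      rw [Finsupp.single_apply, Finsupp.single_apply]
      split_ifs
      · rfl
      · rw [map_zero]
  have h2 : R.classify (s • x) b = single q (π b) := by
    have h3 : R.classify (s • x) b = tiltPow s q * R.classify x b := by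
      rw [← D.classify_specialFibre R π hf hπ hker, ← D.classify_specialFibre R π hf hπ hker]
      refine Eq.trans ?_ (hb.classify_smul s (D.iso.app S x))
      congr 2
      exact (D.iso.app S).map_smul s x
    rw [h3, tiltPow_monomialTilt, R.classify_map_point]
    change single q 1 * single 0 (π b) = _
    rw [single_mul_single, add_zero, one_mul]
  rw [R.classify_smul, R.classify_map_point] at h2
  refine (h1 _).symm.trans ?_
  have h4 := congrArg (fun z : S => z.coeff q) h2
  refine h4.trans ?_
  simp

theorem tiltPow_specialFibre (q : NonnegPAdicFrac p) :
    π (tiltPow (D.X.point B R.point) q) =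
      tiltPow (X₀.point B₀ (D.specialFibre R π hf hπ hker).point) q := by
  let := Algebra.compHom B₀ f
  have h := R.classify_tiltPow (D.X.map π R.point) q
  rw [R.classify_map_point] at h
  rw [h]
  congr 1
  exact (D.iso.point_app B₀ _).symm

/-- A homogeneous basis of the special fibre lifts to a deformation along a surjection whose kernel
is generated by a square-zero element. -/
theorem exists_homogeneousBasis [Module.Flat A B] {ε : A} (h₁ : ∀ a, ε * a = 0 ↔ f a = 0)
    (h₂ : ∀ a, f a = 0 ↔ ∃ c, a = ε * c)
    (H₀ : (D.specialFibre R π hf hπ hker).HomogeneousBasis) :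
    ∃ H : R.HomogeneousBasis, ∀ q, π (H.basis q) = H₀.basis q := by
  have hv : ∀ q : NonnegPAdicFrac p, ∃ b : B, R.IsHomogeneous q b ∧ π b = H₀.basis q ∧
      ((q : ℚ≥0) ≤ 1 → b = tiltPow (D.X.point B R.point) q) := by
    intro q
    -- In degrees at most 1 the lift is prescribed; elsewhere any lift is projected to its
    -- homogeneous part, which does not change its reduction.
    by_cases hq : (q : ℚ≥0) ≤ 1
    · refine ⟨_, R.isHomogeneous_tiltPow q, ?_, fun _ => rfl⟩
      rw [D.tiltPow_specialFibre R π hf hπ hker, H₀.eq_tiltPow q hq]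
    · obtain ⟨b, hb⟩ := hπ (H₀.basis q)
      refine ⟨R.proj q b, R.isHomogeneous_proj q b, ?_, fun h => absurd h hq⟩
      rw [D.proj_specialFibre R π hf hπ hker (hb ▸ H₀.homogeneous q), hb]
  choose v hv hπv hvt using hv
  let := Algebra.compHom B₀ f
  let π' : B →ₛₗ[f] B₀ :=
    { toFun := π
      map_add' := map_add π
      map_smul' := fun a b => by
        rw [Algebra.smul_def, Algebra.smul_def, map_mul]
        exact congrArg (· * π b) (π.commutes a) }
  have h₃ : ∀ b, π' b = 0 ↔ ∃ b', b = ε • b' := by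
    intro b
    constructor
    · intro hb
      have h := hker (show b ∈ RingHom.ker π from hb)
      have hle : (RingHom.ker f).map (algebraMap A B) ≤ Ideal.span {algebraMap A B ε} := by
        rw [Ideal.map_le_iff_le_comap]
        intro a ha
        obtain ⟨c, rfl⟩ := (h₂ a).1 ha
        rw [Ideal.mem_comap, map_mul]
        exact Ideal.mul_mem_right _ _ (Ideal.mem_span_singleton_self _)
      obtain ⟨b', hb'⟩ := Ideal.mem_span_singleton'.1 (hle h)
      exact ⟨b', by rw [← hb', Algebra.smul_def, mul_comm]⟩
    · rintro ⟨b', rfl⟩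
      rw [map_smulₛₗ, (h₂ ε).2 ⟨1, (mul_one ε).symm⟩, zero_smul]
  have hπ' : (fun q => π' (v q)) = H₀.basis := funext hπv
  have : RingHomSurjective f := ⟨hf⟩
  let b : Module.Basis (NonnegPAdicFrac p) A B := Module.Basis.mk
    (LinearIndependent.of_flat_squareZero h₁ h₂ h₃ (v := v) (by
      rw [hπ']; exact H₀.basis.linearIndependent))
    (Submodule.span_range_eq_top_of_squareZero h₁ h₂ h₃ (v := v) (by
      rw [hπ']; exact H₀.basis.span_eq)).ge
  have hb (q) : b q = v q := Module.Basis.mk_apply _ _ q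
  exact ⟨⟨b, fun q => hb q ▸ hv q, fun q hq => (hb q).trans (hvt q hq)⟩, fun q => by rw [hb, hπv]⟩

/-- If a basis element of the special fibre is not additive, then some structure constant of the
comultiplication in its degree does not vanish in the special fibre. -/
theorem exists_comulCoeff_ne_zero {H : R.HomogeneousBasis}
    {H₀ : (D.specialFibre R π hf hπ hker).HomogeneousBasis} {d : NonnegPAdicFrac p} (hd : d ≠ 0)
    (h : π (H.basis d) = H₀.basis d) {S : Type u} [CommRing S] [Algebra k S] (x y : X₀.pts S)
    (hxy : (D.specialFibre R π hf hπ hker).classify (x + y) (H₀.basis d) ≠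
      (D.specialFibre R π hf hπ hker).classify x (H₀.basis d) +
        (D.specialFibre R π hf hπ hker).classify y (H₀.basis d)) :
    ∃ i j, i ≠ 0 ∧ j ≠ 0 ∧ i + j = d ∧ f (H.comulCoeff i j) ≠ 0 := by
  by_contra! hne
  let := Algebra.compHom S f
  obtain ⟨x, rfl⟩ := (D.iso.app S).surjective x
  obtain ⟨y, rfl⟩ := (D.iso.app S).surjective y
  rw [← h, ← map_add] at hxy
  refine hxy (((D.classify_specialFibre R π hf hπ hker _ _).trans (H.classify_add_basis hd ?_ x y)).trans
    (congrArg₂ (· + ·) (D.classify_specialFibre R π hf hπ hker _ _).symm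
      (D.classify_specialFibre R π hf hπ hker _ _).symm))
  intro i j hi hj hij
  change algebraMap k S (f (H.comulCoeff i j)) = 0
  rw [hne i j hi hj hij, map_zero]

end

/-- The coordinate ring of the special fibre. -/
theorem exists_specialFibre (B : Type u) [CommRing B] [Algebra A B] (hf : Function.Surjective f) :
    ∃ (B₀ : Type u) (_ : CommRing B₀) (_ : Algebra k B₀)
      (π : letI := Algebra.compHom B₀ f; B →ₐ[A] B₀), Function.Surjective π ∧
        RingHom.ker π ≤ (RingHom.ker f).map (algebraMap A B) := by
  let I := (RingHom.ker f).map (algebraMap A B)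
  let g : A →+* B ⧸ I := (Ideal.Quotient.mk I).comp (algebraMap A B)
  have hg : RingHom.ker f ≤ RingHom.ker g := fun a ha =>
    Ideal.Quotient.eq_zero_iff_mem.2 (Ideal.mem_map_of_mem _ ha)
  let i : Algebra k (B ⧸ I) := (RingHom.liftOfSurjective f hf ⟨g, hg⟩).toAlgebra
  refine ⟨B ⧸ I, inferInstance, i, ?_⟩
  let π : @AlgHom A B (B ⧸ I) _ _ _ _ (Algebra.compHom (B ⧸ I) f) :=
    @AlgHom.mk A B (B ⧸ I) _ _ _ _ (Algebra.compHom (B ⧸ I) f) (Ideal.Quotient.mk I) fun a =>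
      (RingHom.liftOfRightInverse_comp_apply f _ (Function.rightInverse_surjInv hf) ⟨g, hg⟩ a).symm
  exact ⟨π, Ideal.Quotient.mk_surjective, fun b (hb : Ideal.Quotient.mk I b = 0) =>
    Ideal.Quotient.eq_zero_iff_mem.1 hb⟩

end Deformation

end PointedGaPerfModule

/-! ### Deformations over the dual numbers. -/

open PointedGaPerfModule NonnegPAdicFrac

theorem dualNumberReduction_eq_zero_iff {p : ℕ} (a : DualNumber (ZMod p)) :
    dualNumberReduction p a = 0 ↔ ∃ c, a = DualNumber.eps * c := by
  change a.fst = 0 ↔ _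
  constructor
  · intro h
    exact ⟨TrivSqZeroExt.inl a.snd, by ext <;> simp [h]⟩
  · rintro ⟨c, rfl⟩
    simp

theorem eps_mul_eq_zero_iff {p : ℕ} (a : DualNumber (ZMod p)) :
    DualNumber.eps * a = 0 ↔ dualNumberReduction p a = 0 := by
  change _ ↔ a.fst = 0
  rw [TrivSqZeroExt.ext_iff]
  simp

/-- Every deformation of `u^* W[F]` over the dual numbers has a homogeneous basis of functions, and
is isomorphic to `u^* 𝔾ₐ^♯`. -/
theorem exists_homogeneousBasis_noPrimitives {p : ℕ} [hp : Fact p.Prime]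
    (D : Deformation (dualNumberReduction p) (perfWittFrobeniusKernel p)) :
    ∃ (B : Type) (_ : CommRing B) (_ : Algebra (DualNumber (ZMod p)) B)
      (R : D.X.Representation B) (H : R.HomogeneousBasis), H.NoPrimitives := by
  obtain ⟨B, _, _, ξ, hξ, _⟩ := D.flat
  let R : D.X.Representation B := ⟨ξ, hξ⟩
  have hf : Function.Surjective (dualNumberReduction p) := TrivSqZeroExt.fst_surjective
  obtain ⟨B₀, _, _, π, hπ, hker⟩ := Deformation.exists_specialFibre B hf
  let R₀ := D.specialFibre R π hf hπ hker
  let H₀ : R₀.HomogeneousBasis := perfWittFrobeniusKernel.homogeneousBasis R₀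
  obtain ⟨H, hH⟩ := D.exists_homogeneousBasis R π hf hπ hker eps_mul_eq_zero_iff
    dualNumberReduction_eq_zero_iff H₀
  refine ⟨B, inferInstance, inferInstance, R, H, fun n hn => ?_⟩
  obtain ⟨m, rfl⟩ := Nat.exists_eq_add_of_le' hn
  obtain ⟨x, y, hxy⟩ := perfWittFrobeniusKernel.exists_coeff_add_ne p m
  -- The basis element of degree p^{m+1} on the special fibre is the Witt component of index m + 1.
  have hc (z : (perfWittFrobeniusKernel p).pts (TruncatedPerfect p)) :
      R₀.classify z (H₀.basis (nat p (p ^ (m + 1)))) = perfWittFrobeniusKernel.coeff z (m + 1) := by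
    rw [← perfWittFrobeniusKernel.reducedMonomial_pow, ← perfWittFrobeniusKernel.classify_reducedMonomial R₀]
    rw [← perfWittFrobeniusKernel.homogeneousBasis_basis]
  have hd : nat p (p ^ (m + 1)) ≠ 0 := by
    rw [← nat_zero]
    exact fun h => pow_ne_zero _ hp.out.ne_zero (nat_injective h)
  obtain ⟨i, j, hi, hj, hij, hne⟩ := D.exists_comulCoeff_ne_zero R π hf hπ hker (H := H) (H₀ := H₀)
    hd (hH _) x y (by
      change R₀.classify _ _ ≠ R₀.classify _ _ + R₀.classify _ _
      rw [hc, hc, hc]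
      exact hxy)
  -- A dual number over a field with nonzero reduction is a unit, so non-vanishing modulo ε
  -- suffices.
  exact ⟨i, j, hi, hj, hij, TrivSqZeroExt.isUnit_iff_isUnit_fst.2 (isUnit_iff_ne_zero.2 hne)⟩

/-- Every deformation `D` of the pointed `𝔾ₐ^perf`-module `u^* W[F]` over `𝔽_p` to `𝔽_p[ε]/ε²` is
uniquely isomorphic to the trivial one: there is exactly one isomorphism of pointed
`𝔾ₐ^perf`-modules from `D` to the trivial deformation, and it is an isomorphism of deformations. -/
theorem mainTheorem8 (p : ℕ) [Fact p.Prime]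
    (D : PointedGaPerfModule.Deformation (dualNumberReduction p) (perfWittFrobeniusKernel p)) :
    ∃ φ : PointedGaPerfModule.Iso D.X (trivialDeformation p).X,
      D.IsCompatible (trivialDeformation p) φ ∧
      ∀ ψ : PointedGaPerfModule.Iso D.X (trivialDeformation p).X, ψ = φ := by
  obtain ⟨B₀, _, _, ξ, hξ⟩ := (perfWittFrobeniusKernel p).representable
  obtain ⟨B, _, _, R, H, hH⟩ := exists_homogeneousBasis_noPrimitives D
  obtain ⟨B', _, _, R', H', hH'⟩ := exists_homogeneousBasis_noPrimitives (trivialDeformation p)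
  exact Deformation.exists_unique_iso
    (fun E E' => (perfWittFrobeniusKernel.homogeneousBasis ⟨ξ, hξ⟩).dp_unique E E') D _
    (fun E E' => H.dp_unique E E') hH.isUniversal_dividedPowers hH'.isUniversal_dividedPowers
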